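/- Let $n\ge 3$ and let $\mathcal I_{2,n}\subset\mathbb C[p_{ij}\mid 1\le i<j\le n]$ be the Plücker ideal of $\mathrm{Gr}(2,\mathbb C^n)$, i.e. the ideal of all polynomial relations among the $2\times 2$ minors of a generic $n\times 2$ matrix. **Birational and iterated sequences.** For a positive root $\varepsilon_i-\varepsilon_j$ ($i<j$) let $f_{i,j}$ be the elementary $n\times n$ matrix with entry $1$ in position $(j,i)$, so that $\exp(yf_{i,j})=\mathbf 1+yf_{i,j}$. For a sequence $S=(\beta_1,\dots,\beta_d)$ of positive roots, $d=2(n-2)$, let $\psi_S^*(\bar p_{ij})\in\mathbb C[y_1,\dots,y_d]$ be the minor of $\exp(y_1f_{\beta_1})\cdots\exp(y_df_{\beta_d})$ on rows $i<j$ and columns $1,2$. The sequence $S$ is *birational* for $\mathrm{Gr}(2,\mathbb C^n)$ if the induced map from $\mathbb A^d$ to the open cell $\{p_{12}\neq0\}$ of $\mathrm{Gr}(2,\mathbb C^n)$ is birational. *Iterated sequences* are the sequences obtained from a birational sequence for $\mathrm{Gr}(2,\mathbb C^3)$ by successively, for $k=4,\dots,n$, putting $(\varepsilon_{i_k}-\varepsilon_k,\varepsilon_{j_k}-\varepsilon_k)$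 in front of the sequence, where $i_k\ne j_k$ are arbitrary elements of $\{1,\dots,k-1\}$. **The weighting matrix.** Let $\Psi(m)=\sum_k m_k\,\mathrm{ht}(\beta_k)$ for $m\in\mathbb Z^d$, where $\mathrm{ht}(\varepsilon_i-\varepsilon_j)=j-i$, and order $\mathbb Z^d$ by $m\prec_\Psi m'$ iff $\Psi(m)<\Psi(m')$, or $\Psi(m)=\Psi(m')$ and $m>_{\mathrm{lex}}m'$. Let $\mathfrak v_S(\bar p_{ij})$ be the $\prec_\Psi$-minimal exponent of a monomial occurring in $\psi_S^*(\bar p_{ij})$, and let $M_S\in\mathbb Z^{d\times\binom n2}$ be the matrix with columns $\mathfrak v_S(\bar p_{ij})$. **Initial ideals.** For $f=\sum a_u\mathbf p^u$ let $\mathrm{in}_{M_S}(f)$ be the sum of the terms $a_u\mathbf p^u$ with $a_u\ne0$ for which $M_Su$ is minimal with respect to $\prec_\Psi$; for $w\in\mathbb R^{\binom n2}$ let $\mathrm{in}_w(f)$ be the sum of those for which $w\cdot u$ is minimal. Put $\mathrm{in}_{\bullet}(I)=\langle \mathrm{in}_\bullet(f)\mid f\in I\rangle$. **The tree and its cone.**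 Let $T_3$ be the trivalent tree with leaves $1,2,3$. For $k=4,\dots,n$ obtain $T_k$ from $T_{k-1}$ by replacing the edge with leaf $i_k$ by three edges forming a cherry with leaves $i_k$ and $k$; put $T_S=T_n$. Let $w_{T_S}\in\mathbb R^{\binom n2}$ have $(i<j)$-entry minus the number of internal edges on the path from leaf $i$ to leaf $j$ in $T_S$. Let $C_S\subset\mathbb R^{\binom n2}$ be the cone of all vectors whose $(i<j)$-entry is minus the total length of the path from leaf $i$ to leaf $j$, for real edge lengths on $T_S$ that are non-negative on internal edges (this is the maximal cone of $\mathrm{trop}(\mathrm{Gr}(2,\mathbb C^n))$ that corresponds to $T_S$ by Speyer and Sturmfels). **Proposition.** For every iterated sequence $S$ for $\mathrm{Gr}(2,\mathbb C^n)$ we have $\mathrm{in}_{M_S}(\mathcal I_{2,n})=\mathrm{in}_{C_S}(\mathcal I_{2,n})$; that is, $\mathrm{in}_{M_S}(\mathcal I_{2,n})=\mathrm{in}_{w_{T_S}}(\mathcal I_{2,n})$, and $\mathrm{in}_{M_S}(\mathcal I_{2,n})=\mathrm{in}_w(\mathcal I_{2,n})$ for every $w$ in the relative interior of $C_S$. 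-/

import Mathlib

open MvPolynomial

noncomputable section

/-- Pairs `i < j` in `{1, …, n}` (written `0, …, n-1`).  They index the Plücker variables `p_{ij}`
of `Gr(2, ℂⁿ)`, and also the positive roots `ε_i - ε_j` of type `A_{n-1}`. -/
abbrev OrdPair (n : ℕ) : Type := {p : Fin n × Fin n // p.1 < p.2}

/-! ### The Plücker ideal -/

/-- The substitution of the `2 × 2` minor of `x` on rows `i < j` for `p_{ij}`. -/
def minorHom {R : Type*} [CommRing R] [Algebra ℂ R] {n : ℕ} (x : Fin n → Fin 2 → R) :
    MvPolynomial (OrdPair n) ℂ →ₐ[ℂ] R :=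
  aeval fun J => x J.1.1 0 * x J.1.2 1 - x J.1.1 1 * x J.1.2 0

/-- The Plücker ideal `I_{2,n}`: all polynomial relations among the `2 × 2` minors of a generic
`n × 2` matrix, i.e. the ideal of `Gr(2, ℂⁿ)` in its Plücker embedding. -/
def pluckerIdeal (n : ℕ) : Ideal (MvPolynomial (OrdPair n) ℂ) :=
  RingHom.ker (minorHom fun (i : Fin n) (c : Fin 2) =>
    (X (i, c) : MvPolynomial (Fin n × Fin 2) ℂ))

theorem minorHom_eq_zero {R : Type*} [CommRing R] [Algebra ℂ R] {n : ℕ} (x : Fin n → Fin 2 → R)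
    (f : MvPolynomial (OrdPair n) ℂ) (hf : f ∈ pluckerIdeal n) : minorHom x f = 0 := by
  have h : minorHom x = (aeval fun q : Fin n × Fin 2 => x q.1 q.2).comp
      (minorHom fun (i : Fin n) (c : Fin 2) => (X (i, c) : MvPolynomial (Fin n × Fin 2) ℂ)) := by
    apply MvPolynomial.algHom_ext
    intro J
    simp [minorHom]
  have hf' : minorHom (fun (i : Fin n) (c : Fin 2) =>
      (X (i, c) : MvPolynomial (Fin n × Fin 2) ℂ)) f = 0 := hf
  rw [h, AlgHom.comp_apply, hf', map_zero]

/-- The homogeneous coordinate ring `A_{2,n}` of the Grassmannian. -/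
abbrev PluckerRing (n : ℕ) : Type := MvPolynomial (OrdPair n) ℂ ⧸ pluckerIdeal n

/-- The Plücker coordinate `p̄_{ij}`, the class of `p_{ij}` in `A_{2,n}`. -/
def pluckerCoord {n : ℕ} (J : OrdPair n) : PluckerRing n := Ideal.Quotient.mk _ (X J)

/-! ### Initial forms and initial ideals -/

/-- The sum of the terms of `f` whose exponent has minimal weight among the exponents of `f`. -/
def initForm {σ Γ : Type*} [LinearOrder Γ] (wt : (σ →₀ ℕ) → Γ) (f : MvPolynomial σ ℂ) :
    MvPolynomial σ ℂ :=
  ∑ m ∈ f.support with ∀ u ∈ f.support, wt m ≤ wt u, monomial m (coeff m f)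

def initIdeal {σ Γ : Type*} [LinearOrder Γ] (wt : (σ →₀ ℕ) → Γ) (I : Ideal (MvPolynomial σ ℂ)) :
    Ideal (MvPolynomial σ ℂ) :=
  Ideal.span (initForm wt '' (I : Set (MvPolynomial σ ℂ)))

/-- The initial ideal `in_w(I)` for a weight vector `w` with real entries (minimum convention). -/
def initIdealVec {σ : Type*} [Fintype σ] (w : σ → ℝ) (I : Ideal (MvPolynomial σ ℂ)) :
    Ideal (MvPolynomial σ ℂ) :=
  initIdeal (fun m => ∑ j, w j * (m j : ℝ)) I

/-! ### The sequence of roots, its birationality, and its valuation -/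

/-- The height weighted function `Ψ_S(m) = ∑ m_k ht(β_k)`, `ht(ε_i - ε_j) = j - i`. -/
def heightWeight {n : ℕ} (S : List (OrdPair n)) (m : Fin S.length → ℤ) : ℤ :=
  ∑ k, m k * (((S.get k).1.2 : ℤ) - ((S.get k).1.1 : ℤ))

/-- The injection of `ℤ^d` in a linear order which induces the order `≺_Ψ` on `ℤ^d`:
see `psiKey_lt_iff`. -/
def psiKey {n : ℕ} (S : List (OrdPair n)) (m : Fin S.length → ℤ) :
    ℤ ×ₗ (Lex (Fin S.length → ℤ))ᵒᵈ :=
  toLex (heightWeight S m, OrderDual.toDual (toLex m))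

/-- `m ≺_Ψ m'` iff `Ψ(m) < Ψ(m')`, or `Ψ(m) = Ψ(m')` and `m >_lex m'`. -/
theorem psiKey_lt_iff {n : ℕ} (S : List (OrdPair n)) (m m' : Fin S.length → ℤ) :
    psiKey S m < psiKey S m' ↔
      heightWeight S m < heightWeight S m' ∨
        heightWeight S m = heightWeight S m' ∧ toLex m' < toLex m := by
  simp [psiKey, Prod.Lex.toLex_lt_toLex]

theorem psiKey_injective {n : ℕ} (S : List (OrdPair n)) : Function.Injective (psiKey S) := by
  intro m m' h
  simpa [psiKey] using congrArg (fun z => (ofLex z).2) h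

/-- The initial ideal `in_M(I)` for an integer matrix `M`, where `ℤ^d` is ordered by `≺_Ψ`. -/
def initIdealMat {n : ℕ} {σ : Type*} [Fintype σ] (S : List (OrdPair n))
    (M : Matrix (Fin S.length) σ ℤ) (I : Ideal (MvPolynomial σ ℂ)) :
    Ideal (MvPolynomial σ ℂ) :=
  initIdeal (fun m => psiKey S (M.mulVec fun j => (m j : ℤ))) I

theorem exists_lowestExp {n : ℕ} (S : List (OrdPair n)) (f : MvPolynomial (Fin S.length) ℂ)
    (hf : f ≠ 0) : ∃ u ∈ f.support, ∀ v ∈ f.support,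
      psiKey S (fun k => (u k : ℤ)) ≤ psiKey S (fun k => (v k : ℤ)) :=
  Finset.exists_min_image f.support (fun u => psiKey S (fun k => (u k : ℤ)))
    (Finset.nonempty_iff_ne_empty.mpr (by simpa using hf))

open Classical in
/-- The lowest term valuation on `ℂ[y_1, …, y_d] \ {0}`: the `≺_Ψ`-minimal exponent of `f`
(with the irrelevant value `0` at `f = 0`). -/
def lowestExp {n : ℕ} (S : List (OrdPair n)) (f : MvPolynomial (Fin S.length) ℂ) :
    Fin S.length → ℤ :=
  if hf : f ≠ 0 then fun k => ((exists_lowestExp S f hf).choose k : ℤ) else 0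

/-- The product `exp(y_1 f_{β_1}) ⋯ exp(y_d f_{β_d})`; for `β = ε_i - ε_j` the factor
`exp(y f_β)` is `1 + y E_{ji}`. -/
def rootProduct {n : ℕ} (S : List (OrdPair n)) :
    Matrix (Fin n) (Fin n) (MvPolynomial (Fin S.length) ℂ) :=
  (List.ofFn fun k => Matrix.transvection (S.get k).1.2 (S.get k).1.1 (X k)).prod

/-- The pullback `ψ_S^* : A_{2,n} → ℂ[y_1, …, y_d]`, sending `p̄_{ij}` to the minor of the product
matrix on rows `i < j` and on its first two columns. -/
def seqPullback {n : ℕ} (hn : 2 ≤ n) (S : List (OrdPair n)) :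
    PluckerRing n →ₐ[ℂ] MvPolynomial (Fin S.length) ℂ :=
  Ideal.Quotient.liftₐ (pluckerIdeal n)
    (minorHom fun i c => rootProduct S i (Fin.castLE hn c)) (minorHom_eq_zero _)

/-- The valuation `v_S` (used on elements with non-zero pullback). -/
def seqVal {n : ℕ} (hn : 2 ≤ n) (S : List (OrdPair n)) (a : PluckerRing n) :
    Fin S.length → ℤ :=
  lowestExp S (seqPullback hn S a)

/-- The weighting matrix `M_S`; its columns are the vectors `v_S(p̄_{ij})`. -/
def weightMatrix {n : ℕ} (hn : 2 ≤ n) (S : List (OrdPair n)) :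
    Matrix (Fin S.length) (OrdPair n) ℤ :=
  Matrix.of fun k J => seqVal hn S (pluckerCoord J) k

/-- The Plücker coordinates `p̄_{1r}`, `p̄_{2r}`, `r ≥ 3`, pulled back along `ψ_S`.  Up to sign,
`p̄_{1r}` and `p̄_{2r}` are the coordinate functions of the open cell `U_2^- = {p̄_{12} = 1}`
of the Grassmannian. -/
def cellPullback {n : ℕ} (hn : 2 ≤ n) (S : List (OrdPair n))
    (J : {J : OrdPair n // (J.1.1 : ℕ) < 2 ∧ 2 ≤ (J.1.2 : ℕ)}) : MvPolynomial (Fin S.length) ℂ :=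
  seqPullback hn S (pluckerCoord J.1)

/-- `S` is a birational sequence for `Gr(2, ℂⁿ)`: it has `d = dim Gr(2, ℂⁿ)` entries and the map
`U_{-β_1} × ⋯ × U_{-β_d} → U_2^-` is birational, i.e. the coordinate functions of `U_2^-` pull back
to algebraically independent generators of the field `ℂ(y_1, …, y_d)`. -/
structure IsBirationalSeq {n : ℕ} (hn : 2 ≤ n) (S : List (OrdPair n)) : Prop where
  length_eq : S.length = 2 * (n - 2)
  dominant : AlgebraicIndependent ℂ (cellPullback hn S)
  generates : IntermediateField.adjoin ℂ (Set.range fun J =>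
    algebraMap _ (FractionRing (MvPolynomial (Fin S.length) ℂ)) (cellPullback hn S J)) = ⊤

/-- The root `ε_i - ε_j` for `n`, regarded as a root for `n + 1`. -/
def OrdPair.castSucc {n : ℕ} (p : OrdPair n) : OrdPair (n + 1) :=
  ⟨(p.1.1.castSucc, p.1.2.castSucc), Fin.castSucc_lt_castSucc_iff.mpr p.2⟩

/-- The root `ε_i - ε_{n+1}` for `i ≤ n`. -/
def OrdPair.toLast {n : ℕ} (i : Fin n) : OrdPair (n + 1) :=
  ⟨(i.castSucc, Fin.last n), Fin.castSucc_lt_last i⟩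

/-- Iterated sequences for `Gr(2, ℂⁿ)`: start from a birational sequence for `Gr(2, ℂ³)` and pass
repeatedly from `S` to `(ε_i - ε_{n+1}, ε_j - ε_{n+1}, S)` with `i ≠ j` in `{1, …, n}`. -/
inductive IteratedSeq : ℕ → Type
  | base (S : List (OrdPair 3)) (hS : IsBirationalSeq (by norm_num) S) : IteratedSeq 3
  | extend {n : ℕ} (i j : Fin n) (hij : i ≠ j) (S : IteratedSeq n) : IteratedSeq (n + 1)

/-- The underlying sequence of positive roots. -/
def IteratedSeq.roots : {n : ℕ} → IteratedSeq n → List (OrdPair n)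
  | _, .base S _ => S
  | _, .extend i j _ S => OrdPair.toLast i :: OrdPair.toLast j :: S.roots.map OrdPair.castSucc

theorem IteratedSeq.three_le {n : ℕ} (S : IteratedSeq n) : 3 ≤ n := by
  induction S with
  | base => exact le_rfl
  | extend _ _ _ _ ih => omega

theorem IteratedSeq.two_le {n : ℕ} (S : IteratedSeq n) : 2 ≤ n :=
  le_trans (by norm_num) S.three_le

/-! ### Labelled trivalent trees -/

/-- A trivalent tree with leaves labelled by `{1, …, n}`. -/
structure TrivalentTree (n : ℕ) where
  Inner : Type
  finite_inner : Finite Inner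
  graph : SimpleGraph (Fin n ⊕ Inner)
  isTree : graph.IsTree
  leaf_valency : ∀ l : Fin n, (graph.neighborSet (Sum.inl l)).ncard = 1
  inner_valency : ∀ c : Inner, (graph.neighborSet (Sum.inr c)).ncard = 3

attribute [instance] TrivalentTree.finite_inner

/-- The tree `T_3` with three leaves and one internal vertex. -/
def tripod : TrivalentTree 3 where
  Inner := Unit
  finite_inner := inferInstance
  graph := completeBipartiteGraph (Fin 3) Unit
  isTree := by
    rw [SimpleGraph.isTree_iff_connected_and_card]
    have hr : ∀ v : Fin 3 ⊕ Unit,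
        (completeBipartiteGraph (Fin 3) Unit).Reachable v (Sum.inr ()) := by
      rintro (l | ⟨⟩)
      · exact SimpleGraph.Adj.reachable (by simp)
      · exact SimpleGraph.Reachable.refl _
    refine ⟨⟨fun u v => (hr u).trans (hr v).symm⟩, ?_⟩
    have he : (completeBipartiteGraph (Fin 3) Unit).edgeSet =
        Set.range fun l : Fin 3 => s(Sum.inl l, Sum.inr ()) := by
      ext e
      induction e using Sym2.ind with
      | _ a b => rcases a with a | a <;> rcases b with b | b <;> simp
    rw [he, Nat.card_coe_set_eq, ← Set.image_univ, Set.ncard_image_of_injective]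
    · simp
    · intro a b h
      simpa using h
  leaf_valency l := by
    have h : (completeBipartiteGraph (Fin 3) Unit).neighborSet (Sum.inl l) = {Sum.inr ()} := by
      ext (v | v) <;> simp
    rw [h, Set.ncard_singleton]
  inner_valency c := by
    have h : (completeBipartiteGraph (Fin 3) Unit).neighborSet (Sum.inr c) =
        Set.range Sum.inl := by
      ext (v | v) <;> simp
    rw [h, ← Set.image_univ, Set.ncard_image_of_injective _ Sum.inl_injective]
    simp

namespace TrivalentTree

variable {n : ℕ}

/-- Relabelling of the old vertices when a cherry is attached at leaf `i`: the old end point of the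
edge with leaf `i` becomes the new internal vertex `none`. -/
def cherryEmb (T : TrivalentTree n) (i : Fin n) :
    Fin n ⊕ T.Inner ↪ Fin (n + 1) ⊕ Option T.Inner where
  toFun
    | .inl l => if l = i then .inr none else .inl l.castSucc
    | .inr c => .inr (some c)
  inj' := by
    rintro (l | c) (l' | c') h
    · by_cases h1 : l = i <;> by_cases h2 : l' = i <;> simp_all
    · by_cases h1 : l = i <;> simp_all
    · by_cases h2 : l' = i <;> simp_all
    · simp_all

/-- The graph obtained by replacing the edge with leaf `i` by three edges forming a cherry with
leaves `i` and `n + 1`. -/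
def cherryGraph (T : TrivalentTree n) (i : Fin n) :
    SimpleGraph (Fin (n + 1) ⊕ Option T.Inner) :=
  T.graph.map (T.cherryEmb i) ⊔ SimpleGraph.edge (.inr none) (.inl i.castSucc) ⊔
    SimpleGraph.edge (.inr none) (.inl (Fin.last n))

theorem cherryEmb_self (T : TrivalentTree n) (i : Fin n) :
    T.cherryEmb i (.inl i) = .inr none := if_pos rfl

theorem cherryEmb_of_ne (T : TrivalentTree n) {i l : Fin n} (h : l ≠ i) :
    T.cherryEmb i (.inl l) = .inl l.castSucc := if_neg h

theorem cherryEmb_inner (T : TrivalentTree n) (i : Fin n) (c : T.Inner) :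
    T.cherryEmb i (.inr c) = .inr (some c) := rfl

theorem cherryEmb_ne_self (T : TrivalentTree n) (i : Fin n) (v : Fin n ⊕ T.Inner) :
    T.cherryEmb i v ≠ .inl i.castSucc := by
  rcases v with l | c
  · by_cases h : l = i
    · subst h
      simp [cherryEmb_self]
    · simpa [cherryEmb_of_ne T h] using h
  · simp [cherryEmb_inner]

theorem cherryEmb_ne_last (T : TrivalentTree n) (i : Fin n) (v : Fin n ⊕ T.Inner) :
    T.cherryEmb i v ≠ .inl (Fin.last n) := by
  rcases v with l | c
  · by_cases h : l = i
    · subst h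
      simp [cherryEmb_self]
    · simp [cherryEmb_of_ne T h]
  · simp [cherryEmb_inner]

theorem cherry_cases (T : TrivalentTree n) (i : Fin n) (v : Fin (n + 1) ⊕ Option T.Inner) :
    (∃ u, T.cherryEmb i u = v) ∨ v = .inl i.castSucc ∨ v = .inl (Fin.last n) := by
  rcases v with l | (_ | c)
  · induction l using Fin.lastCases with
    | last => exact Or.inr (Or.inr rfl)
    | cast l =>
      by_cases h : l = i
      · exact Or.inr (Or.inl (by rw [h]))
      · exact Or.inl ⟨.inl l, cherryEmb_of_ne T h⟩
  · exact Or.inl ⟨.inl i, cherryEmb_self T i⟩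
  · exact Or.inl ⟨.inr c, rfl⟩

theorem cherryGraph_isTree (T : TrivalentTree n) (i : Fin n) : (T.cherryGraph i).IsTree := by
  rw [SimpleGraph.isTree_iff_connected_and_card]
  have hle : T.graph.map (T.cherryEmb i) ≤ T.cherryGraph i := le_trans le_sup_left le_sup_left
  have h1 : (T.cherryGraph i).Adj (.inr none) (.inl i.castSucc) := by
    simp [cherryGraph, SimpleGraph.edge_adj]
  have h2 : (T.cherryGraph i).Adj (.inr none) (.inl (Fin.last n)) := by
    simp [cherryGraph, SimpleGraph.edge_adj]
  have hr : ∀ v, (T.cherryGraph i).Reachable (.inr none) v := by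
    intro v
    rcases cherry_cases T i v with ⟨u, rfl⟩ | rfl | rfl
    · have h := T.isTree.connected.preconnected (.inl i) u
      have h' := (h.map (SimpleGraph.Embedding.map (T.cherryEmb i) T.graph).toHom).mono hle
      rwa [← cherryEmb_self T i]
    · exact h1.reachable
    · exact h2.reachable
  refine ⟨⟨fun u v => (hr u).symm.trans (hr v)⟩, ?_⟩
  have hT := (SimpleGraph.isTree_iff_connected_and_card.mp T.isTree).2
  have he : (T.cherryGraph i).edgeSet =
      insert s(.inr none, .inl (Fin.last n)) (insert s(.inr none, .inl i.castSucc)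
        ((T.cherryEmb i).sym2Map '' T.graph.edgeSet)) := by
    rw [cherryGraph, SimpleGraph.edgeSet_sup, SimpleGraph.edgeSet_sup, SimpleGraph.edgeSet_map,
      SimpleGraph.edgeSet_edge, SimpleGraph.edgeSet_edge]
    ext e
    simp only [Set.mem_union, Set.mem_sdiff, Set.mem_insert_iff, Set.mem_singleton_iff]
    constructor
    · tauto
    · rintro (rfl | rfl | h)
      · exact Or.inr ⟨rfl, by simp⟩
      · exact Or.inl (Or.inr ⟨rfl, by simp⟩)
      · exact Or.inl (Or.inl h)
  have hn : ∀ x, (∀ v, T.cherryEmb i v ≠ x) → ∀ y,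
      s(y, x) ∉ (T.cherryEmb i).sym2Map '' T.graph.edgeSet := by
    rintro x hx y ⟨e, -, he⟩
    induction e using Sym2.ind with
    | _ a b =>
      simp only [Function.Embedding.sym2Map_apply, Sym2.map_mk, Sym2.eq_iff] at he
      rcases he with ⟨-, h⟩ | ⟨h, -⟩
      · exact hx _ h
      · exact hx _ h
  rw [he, Nat.card_coe_set_eq, Set.ncard_insert_of_notMem, Set.ncard_insert_of_notMem,
    Set.ncard_image_of_injective _ (Function.Embedding.injective _), ← Nat.card_coe_set_eq]
  · have := Fintype.ofFinite T.Inner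
    simp only [Nat.card_eq_fintype_card (α := Fin _ ⊕ _), Fintype.card_sum, Fintype.card_fin,
      Fintype.card_option] at hT ⊢
    omega
  · exact hn _ (cherryEmb_ne_self T i) _
  · rw [Set.mem_insert_iff, not_or]
    refine ⟨?_, hn _ (cherryEmb_ne_last T i) _⟩
    simp [(Fin.castSucc_ne_last i).symm]

theorem cherry_neighborSet (T : TrivalentTree n) (i : Fin n) (u : Fin n ⊕ T.Inner)
    (hu : u ≠ .inl i) : (T.cherryGraph i).neighborSet (T.cherryEmb i u) =
      T.cherryEmb i '' T.graph.neighborSet u := by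
  have h0 : T.cherryEmb i u ≠ .inr none := by
    rw [← cherryEmb_self T i]
    exact fun h => hu ((T.cherryEmb i).injective h)
  ext v
  simp [cherryGraph, SimpleGraph.edge_adj, h0, cherryEmb_ne_self, cherryEmb_ne_last]

theorem cherry_neighborSet_none (T : TrivalentTree n) (i : Fin n) :
    (T.cherryGraph i).neighborSet (.inr none) = insert (.inl i.castSucc)
      (insert (.inl (Fin.last n)) (T.cherryEmb i '' T.graph.neighborSet (.inl i))) := by
  ext v
  rw [SimpleGraph.mem_neighborSet, cherryGraph, SimpleGraph.sup_adj, SimpleGraph.sup_adj,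
    SimpleGraph.map_adj, SimpleGraph.edge_adj, SimpleGraph.edge_adj]
  simp only [Set.mem_insert_iff, Set.mem_image, SimpleGraph.mem_neighborSet]
  constructor
  · rintro ((⟨a, b, hab, ha, rfl⟩ | h) | h)
    · rw [← cherryEmb_self T i] at ha
      obtain rfl := (T.cherryEmb i).injective ha
      exact Or.inr (Or.inr ⟨b, hab, rfl⟩)
    · rcases h with ⟨⟨-, h⟩ | ⟨h, -⟩, -⟩
      · exact Or.inl h
      · simp at h
    · rcases h with ⟨⟨-, h⟩ | ⟨h, -⟩, -⟩
      · exact Or.inr (Or.inl h)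
      · simp at h
  · rintro (rfl | rfl | ⟨b, hb, rfl⟩)
    · simp
    · simp
    · exact Or.inl (Or.inl ⟨_, b, hb, cherryEmb_self T i, rfl⟩)

theorem cherry_neighborSet_leaf (T : TrivalentTree n) (i : Fin n) (x : Fin (n + 1))
    (hx : x = i.castSucc ∨ x = Fin.last n) :
    (T.cherryGraph i).neighborSet (.inl x) = {.inr none} := by
  have hne : ∀ v, T.cherryEmb i v ≠ .inl x := by
    rcases hx with rfl | rfl
    · exact cherryEmb_ne_self T i
    · exact cherryEmb_ne_last T i
  ext v
  rw [SimpleGraph.mem_neighborSet, cherryGraph, SimpleGraph.sup_adj, SimpleGraph.sup_adj,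
    SimpleGraph.map_adj, SimpleGraph.edge_adj, SimpleGraph.edge_adj, Set.mem_singleton_iff]
  constructor
  · rintro ((⟨a, b, -, ha, -⟩ | h) | h)
    · exact absurd ha (hne a)
    · rcases h with ⟨⟨h, -⟩ | ⟨-, h⟩, -⟩
      · simp at h
      · exact h
    · rcases h with ⟨⟨h, -⟩ | ⟨-, h⟩, -⟩
      · simp at h
      · exact h
  · rintro rfl
    rcases hx with rfl | rfl <;> simp

/-- The tree obtained from `T` by replacing the edge with leaf `i` by three edges forming a cherry
with leaves labelled `i` and `n + 1`. -/
def attachCherry (T : TrivalentTree n) (i : Fin n) : TrivalentTree (n + 1) where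
  Inner := Option T.Inner
  finite_inner := inferInstance
  graph := T.cherryGraph i
  isTree := T.cherryGraph_isTree i
  leaf_valency l := by
    rcases cherry_cases T i (.inl l) with ⟨u, hu⟩ | h | h
    · rcases u with u | c
      · by_cases hui : u = i
        · rw [hui, cherryEmb_self] at hu
          simp at hu
        · rw [← hu, cherry_neighborSet T i _ (by simpa using hui),
            Set.ncard_image_of_injective _ (T.cherryEmb i).injective, T.leaf_valency]
      · simp [cherryEmb_inner] at hu
    · rw [cherry_neighborSet_leaf T i l (Or.inl (Sum.inl_injective h)), Set.ncard_singleton]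
    · rw [cherry_neighborSet_leaf T i l (Or.inr (Sum.inl_injective h)), Set.ncard_singleton]
  inner_valency c := by
    rcases c with _ | c
    · rw [cherry_neighborSet_none, Set.ncard_insert_of_notMem, Set.ncard_insert_of_notMem,
        Set.ncard_image_of_injective _ (T.cherryEmb i).injective, T.leaf_valency]
      · rintro ⟨v, -, hv⟩
        exact cherryEmb_ne_last T i v hv
      · rw [Set.mem_insert_iff, not_or]
        refine ⟨by simp, ?_⟩
        rintro ⟨v, -, hv⟩
        exact cherryEmb_ne_self T i v hv
    · rw [← cherryEmb_inner T i c, cherry_neighborSet T i _ (by simp),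
        Set.ncard_image_of_injective _ (T.cherryEmb i).injective, T.inner_valency]

/-- The edges connecting two internal vertices. -/
def internalEdges (T : TrivalentTree n) : Set (Sym2 (Fin n ⊕ T.Inner)) :=
  {e ∈ T.graph.edgeSet | ∃ a b : T.Inner, e = s(.inr a, .inr b)}

/-- The edges on the path from leaf `i` to leaf `j`. -/
def pathEdges (T : TrivalentTree n) (i j : Fin n) : Set (Sym2 (Fin n ⊕ T.Inner)) :=
  {e | ∃ p : T.graph.Walk (.inl i) (.inl j), p.IsPath ∧ e ∈ p.edges}

/-- The weight vector `w_T`: minus the number of internal edges on the path from `i` to `j`. -/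
def weightVector (T : TrivalentTree n) (J : OrdPair n) : ℝ :=
  -((T.pathEdges J.1.1 J.1.2 ∩ T.internalEdges).ncard : ℝ)

/-- The cone `C_T` of the tropical Grassmannian corresponding to `T`: all vectors of negatives of
leaf-to-leaf distances in `T`, for real edge lengths that are non-negative on internal edges. -/
def cone (T : TrivalentTree n) : Set (OrdPair n → ℝ) :=
  {w | ∃ len : Sym2 (Fin n ⊕ T.Inner) → ℝ, (∀ e ∈ T.internalEdges, 0 ≤ len e) ∧
    ∀ J : OrdPair n, w J = -∑ᶠ e ∈ T.pathEdges J.1.1 J.1.2, len e}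

end TrivalentTree

/-- The tree `T_S`: starting from `T_3`, a cherry with leaves `i_k` and `k` is attached at the leaf
`i_k` for every extension of the sequence by `(ε_{i_k} - ε_k, ε_{j_k} - ε_k)`. -/
def IteratedSeq.tree : {n : ℕ} → IteratedSeq n → TrivalentTree n
  | _, .base _ _ => tripod
  | _, .extend i _ _ S => S.tree.attachCherry i

end

/-!
Both initial ideals are equal to one toric ideal which depends only on the cherries attached in the
construction of `S`, namely the kernel of the map `toricHom S : p_{rs} ↦ z_r z_s c_{rs}`, where the
`c_{rs}` are signed monomials with `c_{r,n+1} = c_{ri}` for `r ≠ i` and `c_{i,n+1} = y c_{ij}` with a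
new variable `y` when a cherry with leaves `i` and `n + 1` is attached.

A weight `w` on the Plücker variables, with values in any ordered abelian group, is called a tree
weight (`IsTreeWeight`) if at each attachment `w_{r,n+1} - w_{ri}` is independent of `r ≠ i` and the
strict four point condition `w_{r,n+1} + w_{is} < w_{i,n+1} + w_{rs}` holds. For every tree weight
the initial ideal of the Plücker ideal is the toric ideal (`IsTreeWeight.initIdeal_eq`).

* The initial ideal is contained in the toric ideal, because the point with coordinates
  `z_r z_s c_{rs}` lifts to a point of the Grassmannian over Hahn series whose coordinates have the
  leading terms `z_r z_s c_{rs} t^{w_{rs}}`: the row `n + 1` of a representing matrix is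
  `t^a x_i + y t^b x_j`, and the four point condition prevents the second summand from
  contributing to the leading terms of the minors with the rows `r ≠ i`
  (`IsTreeWeight.exists_rows`, `aeval_initForm_eq_zero`).
* The toric ideal is contained in the initial ideal by induction on the number of leaves. The
  three-term Plücker relations degenerate to the exchange binomials
  `p_{ri} p_{s,n+1} - p_{si} p_{r,n+1}`, and the derivation which replaces `i` by `n + 1` preserves
  the Plücker ideal and shifts the weight by a constant, so that it preserves the initial ideal.
  The toric ideal is spanned by binomials (`ker_le_of_binomial_mem`). The contraction of `n + 1` to
  `i` maps such a binomial to one for the smaller tree, and iterating the derivation on the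
  contracted binomial recovers the original one modulo the exchange binomials, up to a non-zero
  factor (`exists_iterate_derivation_sub_mem`, `IsTreeWeight.ker_toricHom_le`).

It remains to see that the weights of the statement are tree weights. For minus the leaf-to-leaf
distances of the tree with positive lengths on internal edges this is `isTreeWeight_of_innerDist`: the
edge which separates a cherry from the rest of the tree makes the inequality strict. It applies to
`w_{T_S}`, where all internal lengths are `1`, and to the points of the relative interior of the cone
(`isTreeWeight_of_mem_intrinsicInterior`). For the columns of `M_S` it is
`isTreeWeight_columnWeight`: the minors of the product matrix satisfy
`p_{r,n+1} = y₀ p_{ri} + y₁ p_{rj}` and are homogeneous for the height, so that the minimal exponent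
for `≺_Ψ` is the lexicographically largest one, which for `r ≠ i` comes from `y₀ p_{ri}`.
-/

noncomputable section

/-! ### Initial ideals for additive weights -/

section InitialIdeals

variable {σ σ' Γ : Type*} [AddCommGroup Γ] [LinearOrder Γ]

/-- The polynomials all of whose exponents have weight strictly larger than `γ`. -/
def aboveWeight (w : σ → Γ) (γ : Γ) : Submodule ℂ (MvPolynomial σ ℂ) :=
  restrictSupport ℂ {m | γ < Finsupp.weight w m}

theorem mem_aboveWeight {w : σ → Γ} {γ : Γ} {f : MvPolynomial σ ℂ} :
    f ∈ aboveWeight w γ ↔ ∀ m, coeff m f ≠ 0 → γ < Finsupp.weight w m := by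
  rw [aboveWeight, mem_restrictSupport_iff]
  simp [Set.subset_def, mem_support_iff]

theorem coeff_initForm {Δ : Type*} [LinearOrder Δ] (wt : (σ →₀ ℕ) → Δ) (f : MvPolynomial σ ℂ)
    (m : σ →₀ ℕ) [Decidable (m ∈ f.support ∧ ∀ u ∈ f.support, wt m ≤ wt u)] :
    coeff m (initForm wt f) =
      if m ∈ f.support ∧ ∀ u ∈ f.support, wt m ≤ wt u then coeff m f else 0 := by
  classical
  simp only [initForm, coeff_sum, coeff_monomial, Finset.sum_ite_eq', Finset.mem_filter]

/-- A non-zero homogeneous polynomial is the initial form of its sum with any polynomial of higher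
weight. -/
theorem initForm_add {w : σ → Γ} {γ : Γ} {g h : MvPolynomial σ ℂ} (hg0 : g ≠ 0)
    (hg : IsWeightedHomogeneous w g γ) (hh : h ∈ aboveWeight w γ) :
    initForm (Finsupp.weight w) (g + h) = g := by
  classical
  rw [mem_aboveWeight] at hh
  have key : ∀ m, coeff m g ≠ 0 → coeff m h = 0 := fun m hm => by
    by_contra h0
    exact absurd (hg hm) (hh m h0).ne'
  obtain ⟨m₀, hm₀⟩ := ne_zero_iff.mp hg0
  ext m
  rw [coeff_initForm]
  simp only [mem_support_iff, coeff_add]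
  by_cases hm : coeff m g = 0
  · rw [hm, zero_add, ite_eq_right_iff]
    rintro ⟨h1, h2⟩
    have := h2 m₀ (by rwa [key m₀ hm₀, add_zero])
    rw [hg hm₀] at this
    exact absurd (hh m h1) (not_lt.mpr this)
  · rw [key m hm, add_zero, if_pos]
    refine ⟨hm, fun u hu => ?_⟩
    rw [hg hm]
    by_cases hu' : coeff u g = 0
    · rw [hu', zero_add] at hu
      exact (hh u hu).le
    · exact (hg hu').ge

theorem exists_initForm_add (w : σ → Γ) {f : MvPolynomial σ ℂ} (hf : f ≠ 0) :
    ∃ γ, ∃ h ∈ aboveWeight w γ, IsWeightedHomogeneous w (initForm (Finsupp.weight w) f) γ ∧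
      f = initForm (Finsupp.weight w) f + h := by
  classical
  obtain ⟨m₀, hm₀, hmin⟩ := Finset.exists_min_image f.support (Finsupp.weight w)
    (Finset.nonempty_iff_ne_empty.mpr (by simpa using hf))
  refine ⟨Finsupp.weight w m₀, f - initForm (Finsupp.weight w) f, ?_, ?_, by ring⟩
  · rw [mem_aboveWeight]
    intro m hm
    rw [coeff_sub, coeff_initForm] at hm
    by_contra hlt
    rw [not_lt] at hlt
    have hms : m ∈ f.support := by
      rw [mem_support_iff]
      intro h0
      simp [h0] at hm
    rw [if_pos ⟨hms, fun u hu => hlt.trans (hmin u hu)⟩, sub_self] at hm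
    exact hm rfl
  · intro m hm
    rw [coeff_initForm] at hm
    split_ifs at hm with h
    · exact le_antisymm (h.2 m₀ hm₀) (hmin m h.1)
    · exact absurd rfl hm

theorem initForm_zero {Δ : Type*} [LinearOrder Δ] (wt : (σ →₀ ℕ) → Δ) :
    initForm wt (0 : MvPolynomial σ ℂ) = 0 := by
  simp [initForm]

theorem mem_initIdeal_of_add_mem {w : σ → Γ} {γ : Γ} {I : Ideal (MvPolynomial σ ℂ)}
    {g h : MvPolynomial σ ℂ} (hg : IsWeightedHomogeneous w g γ) (hh : h ∈ aboveWeight w γ)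
    (hI : g + h ∈ I) : g ∈ initIdeal (Finsupp.weight w) I := by
  by_cases hg0 : g = 0
  · rw [hg0]
    exact zero_mem _
  · exact Ideal.subset_span ⟨g + h, hI, initForm_add hg0 hg hh⟩

/-- A linear map which shifts weights by `a` and maps `I` to `I'` maps initial forms of elements
of `I` into the initial ideal of `I'`. -/
theorem map_initForm_mem [IsOrderedAddMonoid Γ] {w : σ → Γ} {w' : σ' → Γ} (a : Γ)
    {I : Ideal (MvPolynomial σ ℂ)}
    {I' : Ideal (MvPolynomial σ' ℂ)} (L : MvPolynomial σ ℂ →ₗ[ℂ] MvPolynomial σ' ℂ)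
    (hL : ∀ u, IsWeightedHomogeneous w' (L (monomial u 1)) (Finsupp.weight w u + a))
    (hI : ∀ f ∈ I, L f ∈ I') {f : MvPolynomial σ ℂ} (hf : f ∈ I) :
    L (initForm (Finsupp.weight w) f) ∈ initIdeal (Finsupp.weight w') I' := by
  have hexp : ∀ g : MvPolynomial σ ℂ, L g = ∑ u ∈ g.support, coeff u g • L (monomial u 1) := by
    intro g
    conv_lhs => rw [g.as_sum, map_sum]
    refine Finset.sum_congr rfl fun u _ => ?_
    rw [← map_smul, smul_monomial, smul_eq_mul, mul_one]
  by_cases hf0 : f = 0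
  · rw [hf0, initForm_zero, map_zero]
    exact zero_mem _
  obtain ⟨γ, h, hh, hg, hfe⟩ := exists_initForm_add w hf0
  refine mem_initIdeal_of_add_mem (γ := γ + a) (h := L h) ?_ ?_ ?_
  · rw [hexp]
    refine IsWeightedHomogeneous.sum _ _ _ fun u hu => ?_
    have := hL u
    rw [hg (mem_support_iff.mp hu)] at this
    exact (weightedHomogeneousSubmodule ℂ w' (γ + a)).smul_mem _ this
  · rw [hexp]
    refine Submodule.sum_mem _ fun u hu => Submodule.smul_mem _ _ ?_
    rw [mem_aboveWeight] at hh ⊢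
    intro m hm
    rw [hL u hm]
    simpa using hh u (mem_support_iff.mp hu)
  · rw [← map_add, ← hfe]
    exact hI f hf

theorem initIdeal_map_le [IsOrderedAddMonoid Γ] {w : σ → Γ} {w' : σ' → Γ}
    {I : Ideal (MvPolynomial σ ℂ)}
    {I' : Ideal (MvPolynomial σ' ℂ)} (φ : MvPolynomial σ ℂ →ₐ[ℂ] MvPolynomial σ' ℂ)
    (hφ : ∀ u, IsWeightedHomogeneous w' (φ (monomial u 1)) (Finsupp.weight w u))
    (hI : ∀ f ∈ I, φ f ∈ I') {f : MvPolynomial σ ℂ} (hf : f ∈ initIdeal (Finsupp.weight w) I) :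
    φ f ∈ initIdeal (Finsupp.weight w') I' := by
  suffices h : initIdeal (Finsupp.weight w) I ≤
      (initIdeal (Finsupp.weight w') I').comap φ.toRingHom from h hf
  refine Ideal.span_le.mpr ?_
  rintro _ ⟨f, hf, rfl⟩
  exact map_initForm_mem 0 φ.toLinearMap (by simpa using hφ) hI hf

/-- A derivation which is homogeneous for the weight and preserves an ideal preserves its initial
ideal. -/
theorem derivation_mem_initIdeal [IsOrderedAddMonoid Γ] {w : σ → Γ} (a : Γ)
    {I : Ideal (MvPolynomial σ ℂ)}
    (D : Derivation ℂ (MvPolynomial σ ℂ) (MvPolynomial σ ℂ))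
    (hD : ∀ j, IsWeightedHomogeneous w (D (X j)) (w j + a)) (hI : ∀ f ∈ I, D f ∈ I)
    {f : MvPolynomial σ ℂ} (hf : f ∈ initIdeal (Finsupp.weight w) I) :
    D f ∈ initIdeal (Finsupp.weight w) I := by
  have hmon : ∀ u, IsWeightedHomogeneous w (D (monomial u 1)) (Finsupp.weight w u + a) := by
    have hmul : ∀ u v, IsWeightedHomogeneous w (D (monomial u 1)) (Finsupp.weight w u + a) →
        IsWeightedHomogeneous w (D (monomial v 1)) (Finsupp.weight w v + a) →
        IsWeightedHomogeneous w (D (monomial (u + v) 1)) (Finsupp.weight w (u + v) + a) := by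
      intro u v hu hv
      have h1 := (isWeightedHomogeneous_monomial w u (1 : ℂ) rfl).mul hv
      have h2 := (isWeightedHomogeneous_monomial w v (1 : ℂ) rfl).mul hu
      rw [show monomial (u + v) (1 : ℂ) = monomial u 1 * monomial v 1 by simp [monomial_mul],
        Derivation.leibniz, smul_eq_mul, smul_eq_mul, map_add]
      refine IsWeightedHomogeneous.add ?_ ?_
      · rwa [add_assoc]
      · rwa [add_assoc, add_left_comm]
    have hzero : IsWeightedHomogeneous w (D (monomial 0 1)) (Finsupp.weight w (0 : σ →₀ ℕ) + a) := by
      rw [show monomial 0 (1 : ℂ) = (1 : MvPolynomial σ ℂ) from rfl, Derivation.map_one_eq_zero]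
      exact isWeightedHomogeneous_zero _ _ _
    intro u
    induction u using Finsupp.induction_linear with
    | zero => exact hzero
    | add u v hu hv => exact hmul u v hu hv
    | single j k =>
      induction k with
      | zero => simpa using hzero
      | succ k ih =>
        rw [Finsupp.single_add]
        refine hmul _ _ ih ?_
        rw [Finsupp.weight_single, one_smul]
        exact hD j
  refine Submodule.span_induction ?_ ?_ ?_ ?_ hf
  · rintro _ ⟨f, hf, rfl⟩
    exact map_initForm_mem a D.toLinearMap hmon hI hf
  · rw [map_zero]
    exact zero_mem _
  · intro x y _ _ hx hy
    rw [map_add]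
    exact add_mem hx hy
  · intro q x hx' hx
    rw [smul_eq_mul, Derivation.leibniz, smul_eq_mul, smul_eq_mul]
    exact add_mem (Ideal.mul_mem_left _ _ hx) (Ideal.mul_mem_right _ _ hx')

end InitialIdeals

/-! ### Tree weights and the toric map -/

section Alternating

variable {n : ℕ}

/-- The weight `w_{rs}` for an unordered pair `r ≠ s` (with the irrelevant value `0` if `r = s`). -/
def symWeight {Γ : Type*} [Zero Γ] (w : OrdPair n → Γ) (r s : Fin n) : Γ :=
  if h : r < s then w ⟨(r, s), h⟩ else if h : s < r then w ⟨(s, r), h⟩ else 0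

theorem symWeight_comm {Γ : Type*} [Zero Γ] (w : OrdPair n → Γ) (r s : Fin n) :
    symWeight w r s = symWeight w s r := by
  rcases lt_trichotomy r s with h | h | h <;> simp [symWeight, h, h.not_gt]

theorem symWeight_ordPair {Γ : Type*} [Zero Γ] (w : OrdPair n → Γ) (J : OrdPair n) :
    symWeight w J.1.1 J.1.2 = w J := by
  simp [symWeight, J.2]

theorem symWeight_castSucc {Γ : Type*} [Zero Γ] (w : OrdPair (n + 1) → Γ) (r s : Fin n) :
    symWeight (fun J => w J.castSucc) r s = symWeight w r.castSucc s.castSucc := by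
  rcases lt_trichotomy r s with h | h | h <;> simp [symWeight, h, h.not_gt, OrdPair.castSucc]

/-- The alternating Plücker variable `p_{rs} = -p_{sr}`, with `p_{rr} = 0`. -/
def altVar (r s : Fin n) : MvPolynomial (OrdPair n) ℂ :=
  if h : r < s then X ⟨(r, s), h⟩ else if h : s < r then -X ⟨(s, r), h⟩ else 0

theorem altVar_self (r : Fin n) : altVar r r = 0 := by simp [altVar]

theorem altVar_swap (r s : Fin n) : altVar r s = -altVar s r := by
  rcases lt_trichotomy r s with h | h | h <;> simp [altVar, h, h.not_gt]

theorem altVar_ordPair (J : OrdPair n) : altVar J.1.1 J.1.2 = X J := by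
  simp [altVar, J.2]

theorem altVar_of_lt {r s : Fin n} (h : r < s) : altVar r s = X ⟨(r, s), h⟩ := by
  simp [altVar, h]

theorem isWeightedHomogeneous_altVar {Γ : Type*} [AddCommMonoid Γ] (w : OrdPair n → Γ)
    (r s : Fin n) : IsWeightedHomogeneous w (altVar r s) (symWeight w r s) := by
  rcases lt_trichotomy r s with h | h | h
  · simpa [altVar, symWeight, h] using isWeightedHomogeneous_X ℂ w _
  · simpa [altVar, h] using isWeightedHomogeneous_zero ℂ w _
  · simpa [altVar, symWeight, h, h.not_gt] using (isWeightedHomogeneous_X ℂ w _).neg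

/-- An algebra homomorphism given on the Plücker variables by an alternating function. -/
theorem aeval_altVar {R : Type*} [CommRing R] [Algebra ℂ R] (c : Fin n → Fin n → R)
    (h0 : ∀ r, c r r = 0) (hc : ∀ r s, c r s = -c s r) (r s : Fin n) :
    aeval (fun J : OrdPair n => c J.1.1 J.1.2) (altVar r s) = c r s := by
  rcases lt_trichotomy r s with h | h | h
  · simp [altVar, h]
  · simp [altVar, h, h0]
  · simp [altVar, h, h.not_gt, ← hc]

theorem minorHom_altVar {R : Type*} [CommRing R] [Algebra ℂ R] (x : Fin n → Fin 2 → R)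
    (r s : Fin n) : minorHom x (altVar r s) = x r 0 * x s 1 - x r 1 * x s 0 :=
  aeval_altVar (fun r s => x r 0 * x s 1 - x r 1 * x s 0) (fun _ => by ring) (fun _ _ => by ring) r s

theorem rename_altVar (r s : Fin n) :
    rename OrdPair.castSucc (altVar r s) = altVar r.castSucc s.castSucc := by
  rcases lt_trichotomy r s with h | h | h <;> simp [altVar, h, h.not_gt, OrdPair.castSucc]

theorem plucker_relation_mem (a b c d : Fin n) :
    altVar a b * altVar c d - altVar a c * altVar b d + altVar a d * altVar b c
      ∈ pluckerIdeal n := by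
  rw [pluckerIdeal, RingHom.mem_ker]
  simp only [map_add, map_sub, map_mul, minorHom_altVar]
  ring

theorem rename_mem_pluckerIdeal (f : MvPolynomial (OrdPair n) ℂ) (hf : f ∈ pluckerIdeal n) :
    rename OrdPair.castSucc f ∈ pluckerIdeal (n + 1) := by
  have h : ∀ f : MvPolynomial (OrdPair n) ℂ, minorHom (fun (i : Fin (n + 1)) (c : Fin 2) =>
      (X (i, c) : MvPolynomial (Fin (n + 1) × Fin 2) ℂ)) (rename OrdPair.castSucc f) =
      minorHom (fun (i : Fin n) (c : Fin 2) =>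
        (X (i.castSucc, c) : MvPolynomial (Fin (n + 1) × Fin 2) ℂ)) f := by
    intro f
    simp only [minorHom, aeval_rename]
    rfl
  rw [pluckerIdeal, RingHom.mem_ker, h]
  exact minorHom_eq_zero _ f hf

/-- The derivation `p_{is} ↦ p_{ts}` of the Plücker algebra, i.e. the action of the elementary
matrix which replaces row `i` by row `t`. -/
def rowDerivation (i t : Fin n) :
    Derivation ℂ (MvPolynomial (OrdPair n) ℂ) (MvPolynomial (OrdPair n) ℂ) :=
  mkDerivation ℂ fun J =>
    (if J.1.1 = i then altVar t J.1.2 else 0) + (if J.1.2 = i then altVar J.1.1 t else 0)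

theorem rowDerivation_altVar (i t r s : Fin n) : rowDerivation i t (altVar r s) =
    (if r = i then altVar t s else 0) + (if s = i then altVar r t else 0) := by
  rcases lt_trichotomy r s with h | h | h
  · simp [altVar_of_lt h, rowDerivation, mkDerivation_X]
  · subst h
    rw [altVar_self, map_zero]
    split_ifs
    · rw [altVar_swap t r, neg_add_cancel]
    · rw [add_zero]
  · rw [altVar_swap r s, altVar_of_lt h, map_neg, rowDerivation, mkDerivation_X, neg_add_rev]
    congr 1 <;> split_ifs <;> simp [← altVar_swap]

theorem rowDerivation_mem_pluckerIdeal (i t : Fin n) (f : MvPolynomial (OrdPair n) ℂ)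
    (hf : f ∈ pluckerIdeal n) : rowDerivation i t f ∈ pluckerIdeal n := by
  let x : Fin n → Fin 2 → MvPolynomial (Fin n × Fin 2) ℂ := fun i c => X (i, c)
  let δ : Derivation ℂ (MvPolynomial (Fin n × Fin 2) ℂ) (MvPolynomial (Fin n × Fin 2) ℂ) :=
    mkDerivation ℂ fun q => if q.1 = i then X (t, q.2) else 0
  have h : ∀ f, minorHom x (rowDerivation i t f) = δ (minorHom x f) := by
    intro f
    induction f using MvPolynomial.induction_on with
    | C a => simp [minorHom]
    | add p q hp hq => simp only [map_add, hp, hq]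
    | mul_X p J hp =>
      have hJ : minorHom x (rowDerivation i t (X J)) = δ (minorHom x (X J)) := by
        rw [← altVar_ordPair, rowDerivation_altVar, map_add, minorHom_altVar]
        simp only [apply_ite (minorHom x), map_zero, minorHom_altVar]
        simp only [x, δ, map_sub, Derivation.leibniz, mkDerivation_X, smul_eq_mul]
        split_ifs <;> ring
      simp only [Derivation.leibniz, map_add, map_mul, smul_eq_mul, hp, hJ]
  have hf' : minorHom x f = 0 := hf
  change minorHom x _ = 0
  rw [h, hf', map_zero]

end Alternating

/-- The combinatorial property of a weight `w` on the Plücker variables which is shared by the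
columns of `M_S` and by the interior points of the cone `C_S`: at each extension of the sequence
the new index `n + 1` and `i` form a cherry, i.e. `w_{r,n+1} - w_{r,i}` does not depend on `r`, and
the strict four point condition `w_{r,n+1} + w_{i,s} < w_{i,n+1} + w_{r,s}` holds. -/
def IsTreeWeight {Γ : Type*} [AddCommGroup Γ] [LinearOrder Γ] :
    {n : ℕ} → IteratedSeq n → (OrdPair n → Γ) → Prop
  | _, .base _ _, _ => True
  | n + 1, .extend i _ _ S, w => IsTreeWeight S (fun J => w J.castSucc) ∧
      (∃ a, ∀ r, r ≠ i →
        symWeight w r.castSucc (Fin.last n) = a + symWeight w r.castSucc i.castSucc) ∧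
      ∀ r s, r ≠ i → s ≠ i → r ≠ s →
        symWeight w r.castSucc (Fin.last n) + symWeight w i.castSucc s.castSucc <
          symWeight w i.castSucc (Fin.last n) + symWeight w r.castSucc s.castSucc

/-- The target of the toric map: the polynomial ring with variables `z_r = X (inl r)` which record
the index `r` of a row and variables `y_n = X (inr n)`, one for every extension from `n` to `n + 1`. -/
abbrev ToricRing : Type := MvPolynomial (ℕ ⊕ ℕ) ℂ

/-- The alternating parameters `c_{rs}` of the toric map: `c_{rs} = 1` for `r < s` on three leaves,
and `c_{r,n+1} = c_{ri}` for `r ≠ i`, `c_{i,n+1} = y_n c_{ij}` when a cherry is attached at `i`. -/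
def toricCoeff : {n : ℕ} → IteratedSeq n → Fin n → Fin n → ToricRing
  | _, .base _ _, r, s => if r < s then 1 else if s < r then -1 else 0
  | n + 1, .extend i j _ S, r, s =>
    Fin.lastCases
      (Fin.lastCases 0 (fun s' => if s' = i then X (.inr n) * toricCoeff S j i
        else toricCoeff S i s') s)
      (fun r' => Fin.lastCases (if r' = i then X (.inr n) * toricCoeff S i j
        else toricCoeff S r' i) (fun s' => toricCoeff S r' s') s) r

section ToricCoeff

variable {n : ℕ} {i j : Fin n} {hij : i ≠ j} (S : IteratedSeq n)

theorem toricCoeff_extend_castSucc (r s : Fin n) :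
    toricCoeff (.extend i j hij S) r.castSucc s.castSucc = toricCoeff S r s := by
  simp [toricCoeff]

theorem toricCoeff_extend_last_of_ne {r : Fin n} (hr : r ≠ i) :
    toricCoeff (.extend i j hij S) r.castSucc (Fin.last n) = toricCoeff S r i := by
  simp [toricCoeff, hr]

theorem toricCoeff_extend_last_self :
    toricCoeff (.extend i j hij S) i.castSucc (Fin.last n) = X (.inr n) * toricCoeff S i j := by
  simp [toricCoeff]

theorem toricCoeff_self {n : ℕ} (S : IteratedSeq n) (r : Fin n) : toricCoeff S r r = 0 := by
  induction S with
  | base S hS => simp [toricCoeff]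
  | extend i j hij S ih =>
    induction r using Fin.lastCases with
    | last => simp [toricCoeff]
    | cast r => rw [toricCoeff_extend_castSucc, ih]

theorem toricCoeff_swap {n : ℕ} (S : IteratedSeq n) (r s : Fin n) :
    toricCoeff S r s = -toricCoeff S s r := by
  induction S with
  | base S hS => rcases lt_trichotomy r s with h | h | h <;> simp [toricCoeff, h, h.not_gt]
  | @extend n i j hij S ih =>
    have h : ∀ r : Fin n, toricCoeff (.extend i j hij S) r.castSucc (Fin.last n) =
        -toricCoeff (.extend i j hij S) (Fin.last n) r.castSucc := by
      intro r
      simp only [toricCoeff, Fin.lastCases_castSucc, Fin.lastCases_last]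
      split_ifs
      · rw [ih i j, mul_neg]
      · rw [ih]
    induction r using Fin.lastCases with
    | last =>
      induction s using Fin.lastCases with
      | last => simp [toricCoeff]
      | cast s => rw [h, neg_neg]
    | cast r =>
      induction s using Fin.lastCases with
      | last => exact h r
      | cast s => rw [toricCoeff_extend_castSucc, toricCoeff_extend_castSucc, ih]

/-- `c_{rs}` is a monomial with a non-zero coefficient for `r ≠ s`. -/
theorem exists_toricCoeff_eq_monomial {n : ℕ} (S : IteratedSeq n) {r s : Fin n} (hrs : r ≠ s) :
    ∃ e a, a ≠ 0 ∧ toricCoeff S r s = monomial e a := by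
  induction S with
  | base S hS =>
    rcases hrs.lt_or_gt with h | h
    · exact ⟨0, 1, one_ne_zero, by simp [toricCoeff, h]⟩
    · refine ⟨0, -1, by simp, ?_⟩
      simp only [toricCoeff, h.not_gt, if_false, h, if_true, map_neg]
      rfl
  | @extend n i j hij S ih =>
    have key : ∀ r : Fin n, ∃ e a, a ≠ 0 ∧
        toricCoeff (.extend i j hij S) r.castSucc (Fin.last n) = monomial e a := by
      intro r
      by_cases hr : r = i
      · subst hr
        obtain ⟨e, a, ha, h⟩ := ih hij
        refine ⟨Finsupp.single (.inr n) 1 + e, a, ha, ?_⟩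
        rw [toricCoeff_extend_last_self, h, X, monomial_mul, one_mul]
      · rw [toricCoeff_extend_last_of_ne S hr]
        exact ih hr
    induction r using Fin.lastCases with
    | last =>
      induction s using Fin.lastCases with
      | last => exact absurd rfl hrs
      | cast s =>
        obtain ⟨e, a, ha, h⟩ := key s
        exact ⟨e, -a, neg_ne_zero.mpr ha, by rw [toricCoeff_swap, h, map_neg]⟩
    | cast r =>
      induction s using Fin.lastCases with
      | last => exact key r
      | cast s =>
        rw [toricCoeff_extend_castSucc]
        exact ih (by simpa using hrs)

/-- The variables of `c_{rs}` are among the `X (inr m)`, `m < n`. -/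
theorem isWeightedHomogeneous_toricCoeff {n : ℕ} (S : IteratedSeq n) {M : Type*}
    [AddCommMonoid M] (w : ℕ ⊕ ℕ → M) (hw : ∀ m < n, w (.inr m) = 0) (r s : Fin n) :
    IsWeightedHomogeneous w (toricCoeff S r s) 0 := by
  induction S with
  | base S hS =>
    simp only [toricCoeff]
    split_ifs
    · exact isWeightedHomogeneous_one _ _
    · exact (isWeightedHomogeneous_one _ _).neg
    · exact isWeightedHomogeneous_zero _ _ _
  | @extend n i j hij S ih =>
    have ih' := ih fun m hm => hw m (hm.trans (Nat.lt_succ_self n))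
    have key : ∀ r : Fin n, IsWeightedHomogeneous w
        (toricCoeff (.extend i j hij S) r.castSucc (Fin.last n)) 0 := by
      intro r
      by_cases hr : r = i
      · subst hr
        rw [toricCoeff_extend_last_self]
        have := (isWeightedHomogeneous_X ℂ w (.inr n)).mul (ih' r j)
        rwa [hw n (Nat.lt_succ_self n), add_zero] at this
      · rw [toricCoeff_extend_last_of_ne S hr]
        exact ih' _ _
    induction r using Fin.lastCases with
    | last =>
      induction s using Fin.lastCases with
      | last => rw [toricCoeff_self]; exact isWeightedHomogeneous_zero _ _ _
      | cast s => rw [toricCoeff_swap]; exact (key s).neg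
    | cast r =>
      induction s using Fin.lastCases with
      | last => exact key r
      | cast s => rw [toricCoeff_extend_castSucc]; exact ih' r s

end ToricCoeff

/-- The terms `z_r z_s c_{rs}`. -/
def toricTerm {n : ℕ} (S : IteratedSeq n) (r s : Fin n) : ToricRing :=
  X (.inl r.val) * X (.inl s.val) * toricCoeff S r s

/-- The toric map `p_{rs} ↦ z_r z_s c_{rs}`. -/
def toricHom {n : ℕ} (S : IteratedSeq n) : MvPolynomial (OrdPair n) ℂ →ₐ[ℂ] ToricRing :=
  aeval fun J => toricTerm S J.1.1 J.1.2

theorem toricHom_altVar {n : ℕ} (S : IteratedSeq n) (r s : Fin n) :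
    toricHom S (altVar r s) = X (.inl r.val) * X (.inl s.val) * toricCoeff S r s := by
  have h0 : ∀ r, toricTerm S r r = 0 := fun r => by rw [toricTerm, toricCoeff_self, mul_zero]
  have h1 : ∀ r s, toricTerm S r s = -toricTerm S s r := fun r s => by
    rw [toricTerm, toricTerm, toricCoeff_swap, mul_neg,
      mul_comm (X (.inl r.val) : ToricRing)]
  exact aeval_altVar (toricTerm S) h0 h1 r s

/-- The kernel of a homomorphism to a polynomial ring which maps variables to non-zero terms is
spanned by binomials. -/
theorem ker_le_of_binomial_mem {σ ρ : Type*} (τ : MvPolynomial σ ℂ →ₐ[ℂ] MvPolynomial ρ ℂ)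
    (hτ : ∀ j, ∃ e a, a ≠ 0 ∧ τ (X j) = monomial e a) (I : Ideal (MvPolynomial σ ℂ))
    (hI : ∀ u v (c : ℂ), c ≠ 0 → τ (monomial u 1) = c • τ (monomial v 1) →
      monomial u 1 - c • monomial v (1 : ℂ) ∈ I) : RingHom.ker τ ≤ I := by
  classical
  have hmul : ∀ u v, (∃ e a, a ≠ 0 ∧ τ (monomial u 1) = monomial e a) →
      (∃ e a, a ≠ 0 ∧ τ (monomial v 1) = monomial e a) →
      (∃ e a, a ≠ 0 ∧ τ (monomial (u + v) 1) = monomial e a) := by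
    rintro u v ⟨e, a, ha, h⟩ ⟨e', a', ha', h'⟩
    refine ⟨e + e', a * a', mul_ne_zero ha ha', ?_⟩
    rw [show monomial (u + v) (1 : ℂ) = monomial u 1 * monomial v 1 by simp [monomial_mul],
      map_mul, h, h', monomial_mul]
  have hmon : ∀ u, ∃ e a, a ≠ 0 ∧ τ (monomial u 1) = monomial e a := by
    intro u
    induction u using Finsupp.induction_linear with
    | zero => exact ⟨0, 1, one_ne_zero, map_one τ⟩
    | add u v hu hv => exact hmul u v hu hv
    | single j k =>
      induction k with
      | zero => exact ⟨0, 1, one_ne_zero, by simp⟩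
      | succ k ih =>
        rw [Finsupp.single_add]
        exact hmul _ _ ih (hτ j)
  choose E a ha hE using hmon
  have hsmul : ∀ u (c : ℂ), monomial u c = c • (monomial u 1 : MvPolynomial σ ℂ) := fun u c => by
    rw [smul_monomial, smul_eq_mul, mul_one]
  -- On the span of the images of the monomials, `Λ` is a section of `τ` modulo `I`.
  let π : MvPolynomial σ ℂ →ₗ[ℂ] MvPolynomial σ ℂ ⧸ I := (Ideal.Quotient.mkₐ ℂ I).toLinearMap
  have hπ : ∀ f, π f = 0 ↔ f ∈ I := fun f => Ideal.Quotient.eq_zero_iff_mem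
  let secFun : (ρ →₀ ℕ) → MvPolynomial σ ℂ ⧸ I := fun e =>
    if h : ∃ u, E u = e then (a h.choose)⁻¹ • π (monomial h.choose 1) else 0
  let Λ : MvPolynomial ρ ℂ →ₗ[ℂ] MvPolynomial σ ℂ ⧸ I := (basisMonomials ρ ℂ).constr ℂ secFun
  have hΛ₀ : ∀ e, Λ (monomial e 1) = secFun e := fun e => by
    have := (basisMonomials ρ ℂ).constr_basis ℂ secFun e
    rwa [coe_basisMonomials] at this
  have hΛ : ∀ u, Λ (τ (monomial u 1)) = π (monomial u 1) := by
    intro u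
    have hex : ∃ v, E v = E u := ⟨u, rfl⟩
    have h1 : secFun (E u) = (a hex.choose)⁻¹ • π (monomial hex.choose 1) := dif_pos hex
    have h2 := hI u hex.choose (a u * (a hex.choose)⁻¹)
      (mul_ne_zero (ha _) (inv_ne_zero (ha _))) (by
        rw [hE, hE, hex.choose_spec, smul_monomial, smul_eq_mul, mul_assoc,
          inv_mul_cancel₀ (ha _), mul_one])
    rw [← hπ, map_sub, sub_eq_zero, map_smul] at h2
    rw [h2, hE, show monomial (E u) (a u) = a u • monomial (E u) (1 : ℂ) by
      rw [smul_monomial, smul_eq_mul, mul_one], map_smul, hΛ₀, h1, smul_smul]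
  have hall : ∀ f, Λ (τ f) = π f := by
    intro f
    induction f using MvPolynomial.induction_on' with
    | monomial u c => rw [hsmul, map_smul, map_smul, hΛ, map_smul]
    | add p q hp hq => simp only [map_add, hp, hq]
  intro f hf
  rw [RingHom.mem_ker] at hf
  rw [← hπ, ← hall, hf, map_zero]

/-! ### The toric ideal is contained in the initial ideal -/

section Homogeneity

theorem isWeightedHomogeneous_toricHom_altVar {n : ℕ} (S : IteratedSeq n) {M : Type*}
    [AddCommMonoid M] (W : ℕ ⊕ ℕ → M) (hW : ∀ m < n, W (.inr m) = 0) (r s : Fin n) :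
    IsWeightedHomogeneous W (toricHom S (altVar r s)) (W (.inl r.val) + W (.inl s.val)) := by
  rw [toricHom_altVar]
  have h := ((isWeightedHomogeneous_X ℂ W (.inl r.val)).mul
    (isWeightedHomogeneous_X ℂ W (.inl s.val))).mul (isWeightedHomogeneous_toricCoeff S W hW r s)
  rwa [add_zero] at h

theorem toricHom_altVar_ne_zero {n : ℕ} (S : IteratedSeq n) {r s : Fin n} (hrs : r ≠ s) :
    toricHom S (altVar r s) ≠ 0 := by
  obtain ⟨e, a, ha, h⟩ := exists_toricCoeff_eq_monomial S hrs
  rw [toricHom_altVar, h]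
  exact mul_ne_zero (mul_ne_zero (X_ne_zero _) (X_ne_zero _)) (by simpa using ha)

theorem exists_toricHom_X_eq_monomial {n : ℕ} (S : IteratedSeq n) (J : OrdPair n) :
    ∃ e a, a ≠ 0 ∧ toricHom S (X J) = monomial e a := by
  obtain ⟨e, a, ha, h⟩ := exists_toricCoeff_eq_monomial S J.2.ne
  refine ⟨Finsupp.single (.inl J.1.1.val) 1 + Finsupp.single (.inl J.1.2.val) 1 + e, a, ha, ?_⟩
  rw [← altVar_ordPair, toricHom_altVar, h, X, X, monomial_mul, monomial_mul, one_mul, one_mul]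

theorem algHom_monomial {σ R : Type*} [CommRing R] [Algebra ℂ R] (τ : MvPolynomial σ ℂ →ₐ[ℂ] R)
    (u : σ →₀ ℕ) : τ (monomial u 1) = ∏ j ∈ u.support, τ (X j) ^ u j := by
  rw [monomial_eq, C_1, one_mul, Finsupp.prod, map_prod]
  simp only [map_pow]

theorem toricHom_monomial_ne_zero {n : ℕ} (S : IteratedSeq n) (u : OrdPair n →₀ ℕ) :
    toricHom S (monomial u 1) ≠ 0 := by
  rw [algHom_monomial]
  refine Finset.prod_ne_zero_iff.mpr fun J _ => pow_ne_zero _ ?_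
  rw [← altVar_ordPair]
  exact toricHom_altVar_ne_zero S J.2.ne

theorem isWeightedHomogeneous_toricHom_monomial {n : ℕ} (S : IteratedSeq n) {M : Type*}
    [AddCommMonoid M] (W : ℕ ⊕ ℕ → M) (hW : ∀ m < n, W (.inr m) = 0) (u : OrdPair n →₀ ℕ) :
    IsWeightedHomogeneous W (toricHom S (monomial u 1))
      (∑ J ∈ u.support, u J • (W (.inl J.1.1.val) + W (.inl J.1.2.val))) := by
  rw [algHom_monomial]
  refine IsWeightedHomogeneous.prod _ _ _ fun J _ => ?_
  rw [← altVar_ordPair]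
  exact (isWeightedHomogeneous_toricHom_altVar S W hW _ _).pow _

theorem isWeightedHomogeneous_unique {σ M : Type*} [AddCommMonoid M] {W : σ → M}
    {p q : MvPolynomial σ ℂ} {c : ℂ} {d e : M} (hp0 : p ≠ 0) (hpq : p = c • q)
    (hp : IsWeightedHomogeneous W p d) (hq : IsWeightedHomogeneous W q e) : d = e := by
  refine hp.inj_right hp0 ?_
  rw [hpq]
  exact (weightedHomogeneousSubmodule ℂ W e).smul_mem c hq

/-- For three leaves the degrees with respect to the row variables determine an exponent. -/
theorem eq_of_leafDegree_eq {u v : OrdPair 3 →₀ ℕ}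
    (h : ∀ t : ℕ, ∑ J, u J * ((if J.1.1.val = t then 1 else 0) + if J.1.2.val = t then 1 else 0) =
      ∑ J, v J * ((if J.1.1.val = t then 1 else 0) + if J.1.2.val = t then 1 else 0)) :
    u = v := by
  have huniv : (Finset.univ : Finset (OrdPair 3)) =
      {⟨(0, 1), by decide⟩, ⟨(0, 2), by decide⟩, ⟨(1, 2), by decide⟩} := by decide
  have h0 := h 0
  have h1 := h 1
  have h2 := h 2
  simp [huniv] at h0 h1 h2
  ext J
  have hJ : J ∈ (Finset.univ : Finset (OrdPair 3)) := Finset.mem_univ J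
  rw [huniv] at hJ
  simp only [Finset.mem_insert, Finset.mem_singleton] at hJ
  rcases hJ with rfl | rfl | rfl <;> omega

end Homogeneity

section Cherry

variable {n : ℕ} (i : Fin n)

/-- Products, up to sign, of Plücker variables different from `p_{i,n+1}` in which the index `i`
occurs `a` times and the index `n + 1` occurs `k` times. -/
inductive CherryTerm : ℕ → ℕ → MvPolynomial (OrdPair (n + 1)) ℂ → Prop
  | one : CherryTerm 0 0 1
  | neg {a k μ} : CherryTerm a k μ → CherryTerm a k (-μ)
  | other {a k μ} (r s : Fin n) (hr : r ≠ i) (hs : s ≠ i) (hrs : r ≠ s) :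
      CherryTerm a k μ → CherryTerm a k (altVar r.castSucc s.castSucc * μ)
  | left {a k μ} (r : Fin n) (hr : r ≠ i) :
      CherryTerm a k μ → CherryTerm (a + 1) k (altVar r.castSucc i.castSucc * μ)
  | right {a k μ} (r : Fin n) (hr : r ≠ i) :
      CherryTerm a k μ → CherryTerm a (k + 1) (altVar r.castSucc (Fin.last n) * μ)

/-- The substitution which replaces the index `n + 1` by `i`. -/
def cherryContract : MvPolynomial (OrdPair (n + 1)) ℂ →ₐ[ℂ] MvPolynomial (OrdPair n) ℂ :=
  aeval fun J => altVar (Fin.lastCases (motive := fun _ => Fin n) i id J.1.1)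
    (Fin.lastCases (motive := fun _ => Fin n) i id J.1.2)

theorem cherryContract_altVar (r s : Fin (n + 1)) :
    cherryContract i (altVar r s) = altVar (Fin.lastCases (motive := fun _ => Fin n) i id r)
      (Fin.lastCases (motive := fun _ => Fin n) i id s) :=
  aeval_altVar (fun r s => altVar (Fin.lastCases (motive := fun _ => Fin n) i id r)
    (Fin.lastCases (motive := fun _ => Fin n) i id s)) (fun _ => altVar_self _)
    (fun _ _ => altVar_swap _ _) r s

theorem cherryContract_castSucc (r s : Fin n) :
    cherryContract i (altVar r.castSucc s.castSucc) = altVar r s := by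
  simp [cherryContract_altVar]

theorem cherryContract_last (r : Fin n) :
    cherryContract i (altVar r.castSucc (Fin.last n)) = altVar r i := by
  simp [cherryContract_altVar]

/-- The derivation which replaces the index `i` by `n + 1`. -/
abbrev cherryDerivation : Derivation ℂ (MvPolynomial (OrdPair (n + 1)) ℂ)
    (MvPolynomial (OrdPair (n + 1)) ℂ) := rowDerivation i.castSucc (Fin.last n)

theorem cherryDerivation_other {r s : Fin n} (hr : r ≠ i) (hs : s ≠ i) :
    cherryDerivation i (altVar r.castSucc s.castSucc) = 0 := by
  simp [rowDerivation_altVar, hr, hs]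

theorem cherryDerivation_left {r : Fin n} (hr : r ≠ i) :
    cherryDerivation i (altVar r.castSucc i.castSucc) = altVar r.castSucc (Fin.last n) := by
  simp [rowDerivation_altVar, hr]

theorem cherryDerivation_right {r : Fin n} (hr : r ≠ i) :
    cherryDerivation i (altVar r.castSucc (Fin.last n)) = 0 := by
  simp [rowDerivation_altVar, hr, (Fin.castSucc_ne_last i).symm]

variable {i}

theorem CherryTerm.mul {a k b l : ℕ} {μ ν : MvPolynomial (OrdPair (n + 1)) ℂ}
    (hμ : CherryTerm i a k μ) (hν : CherryTerm i b l ν) :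
    CherryTerm i (a + b) (k + l) (μ * ν) := by
  induction hμ with
  | one => simpa using hν
  | neg _ ih => rw [neg_mul]; exact ih.neg
  | other r s hr hs hrs _ ih => rw [mul_assoc]; exact ih.other r s hr hs hrs
  | left r hr _ ih => rw [mul_assoc, add_right_comm]; exact ih.left r hr
  | right r hr _ ih => rw [mul_assoc, add_right_comm]; exact ih.right r hr

theorem CherryTerm.rename_contract {a : ℕ} {μ : MvPolynomial (OrdPair (n + 1)) ℂ}
    (hμ : CherryTerm i a 0 μ) : rename OrdPair.castSucc (cherryContract i μ) = μ := by
  generalize hk : 0 = k at hμ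
  induction hμ with
  | one => simp
  | neg _ ih => rw [map_neg, map_neg, ih hk]
  | other r s hr hs hrs _ ih =>
    rw [map_mul, map_mul, ih hk, cherryContract_castSucc, rename_altVar]
  | left r hr _ ih => rw [map_mul, map_mul, ih hk, cherryContract_castSucc, rename_altVar]
  | right r hr _ ih => omega

theorem CherryTerm.exists_eq_right_mul {a k : ℕ} {μ : MvPolynomial (OrdPair (n + 1)) ℂ}
    (hμ : CherryTerm i a (k + 1) μ) : ∃ r, r ≠ i ∧ ∃ ν, CherryTerm i a k ν ∧
      μ = altVar r.castSucc (Fin.last n) * ν := by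
  generalize hk : k + 1 = k' at hμ
  induction hμ generalizing k with
  | one => omega
  | neg _ ih =>
    obtain ⟨r, hr, ν, hν, rfl⟩ := ih hk
    exact ⟨r, hr, -ν, hν.neg, by ring⟩
  | other r s hr hs hrs _ ih =>
    obtain ⟨t, ht, ν, hν, rfl⟩ := ih hk
    exact ⟨t, ht, _, hν.other r s hr hs hrs, by ring⟩
  | left r hr _ ih =>
    obtain ⟨t, ht, ν, hν, rfl⟩ := ih hk
    exact ⟨t, ht, _, hν.left r hr, by ring⟩
  | @right a k' μ r hr hμ ih =>
    obtain rfl : k = k' := by omega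
    exact ⟨r, hr, μ, hμ, rfl⟩

section Polarization

/-- Modulo the exchange relations, applying the derivation to a term with `a` factors `p_{ri}`
amounts to `a` times the replacement of any one of these factors by `p_{r,n+1}`. -/
theorem CherryTerm.mul_derivation_sub_mem {I : Ideal (MvPolynomial (OrdPair (n + 1)) ℂ)}
    (hex : ∀ r s : Fin n, r ≠ i → s ≠ i →
      altVar r.castSucc i.castSucc * altVar s.castSucc (Fin.last n) -
        altVar s.castSucc i.castSucc * altVar r.castSucc (Fin.last n) ∈ I)
    {a k : ℕ} {μ : MvPolynomial (OrdPair (n + 1)) ℂ}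
    (hμ : CherryTerm i a k μ) {r : Fin n} (hr : r ≠ i) :
    altVar r.castSucc i.castSucc * cherryDerivation i μ -
      (a : MvPolynomial (OrdPair (n + 1)) ℂ) * (altVar r.castSucc (Fin.last n) * μ) ∈ I := by
  induction hμ with
  | one => simp
  | @neg a k μ _ ih =>
    rw [map_neg]
    convert neg_mem ih using 1
    ring
  | @other a k μ s t hs ht hst _ ih =>
    rw [Derivation.leibniz, cherryDerivation_other i hs ht, smul_zero, add_zero, smul_eq_mul]
    convert I.mul_mem_left (altVar s.castSucc t.castSucc) ih using 1
    ring
  | @left a k μ s hs _ ih =>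
    rw [Derivation.leibniz, cherryDerivation_left i hs, smul_eq_mul, smul_eq_mul]
    convert add_mem (I.mul_mem_left (altVar s.castSucc i.castSucc) ih)
      (I.mul_mem_right μ (hex r s hr hs)) using 1
    push_cast
    ring
  | @right a k μ s hs _ ih =>
    rw [Derivation.leibniz, cherryDerivation_right i hs, smul_zero, add_zero, smul_eq_mul]
    convert I.mul_mem_left (altVar s.castSucc (Fin.last n)) ih using 1
    ring

/-- Contracting `n + 1` to `i` and applying the derivation `k` times recovers a term, up to a
non-zero factor which depends only on its degrees and modulo the exchange relations. -/
theorem exists_iterate_derivation_sub_mem {I : Ideal (MvPolynomial (OrdPair (n + 1)) ℂ)}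
    (hex : ∀ r s : Fin n, r ≠ i → s ≠ i →
      altVar r.castSucc i.castSucc * altVar s.castSucc (Fin.last n) -
        altVar s.castSucc i.castSucc * altVar r.castSucc (Fin.last n) ∈ I)
    (hD : ∀ f ∈ I, cherryDerivation i f ∈ I) (k a : ℕ) :
    ∃ C : ℂ, C ≠ 0 ∧ ∀ μ, CherryTerm i a k μ →
      (cherryDerivation i)^[k] (rename OrdPair.castSucc (cherryContract i μ)) - C • μ ∈ I := by
  induction k generalizing a with
  | zero =>
    refine ⟨1, one_ne_zero, fun μ hμ => ?_⟩
    rw [hμ.rename_contract]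
    simp
  | succ k ih =>
    obtain ⟨C, hC, h⟩ := ih (a + 1)
    refine ⟨C * ((a + 1 : ℕ) : ℂ), mul_ne_zero hC (Nat.cast_ne_zero.mpr a.succ_ne_zero),
      fun μ hμ => ?_⟩
    obtain ⟨r, hr, ν, hν, rfl⟩ := hμ.exists_eq_right_mul
    have h1 := hD _ (h _ (hν.left r hr))
    have h2 := I.mul_mem_left (MvPolynomial.C C) (hν.mul_derivation_sub_mem hex hr)
    rw [map_mul, cherryContract_last, ← cherryContract_castSucc, ← map_mul,
      Function.iterate_succ_apply']
    rw [map_sub, Derivation.map_smul, Derivation.leibniz, cherryDerivation_left i hr,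
      smul_eq_mul, smul_eq_mul] at h1
    convert add_mem h1 h2 using 1
    simp only [smul_eq_C_mul, map_mul, map_natCast]
    push_cast
    ring

theorem iterate_derivation_mem {I : Ideal (MvPolynomial (OrdPair (n + 1)) ℂ)}
    (hD : ∀ f ∈ I, cherryDerivation i f ∈ I) (k : ℕ) {f : MvPolynomial (OrdPair (n + 1)) ℂ}
    (hf : f ∈ I) : (cherryDerivation i)^[k] f ∈ I := by
  induction k with
  | zero => exact hf
  | succ k ih =>
    rw [Function.iterate_succ_apply']
    exact hD _ ih

theorem iterate_derivation_sub_smul (k : ℕ) (f g : MvPolynomial (OrdPair (n + 1)) ℂ) (c : ℂ) :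
    (cherryDerivation i)^[k] (f - c • g) =
      (cherryDerivation i)^[k] f - c • (cherryDerivation i)^[k] g := by
  induction k with
  | zero => rfl
  | succ k ih => rw [Function.iterate_succ_apply', ih, map_sub, Derivation.map_smul,
      Function.iterate_succ_apply', Function.iterate_succ_apply']

/-- A binomial relation between terms of the same degrees lifts along the contraction. -/
theorem CherryTerm.sub_smul_mem {I : Ideal (MvPolynomial (OrdPair (n + 1)) ℂ)}
    (hex : ∀ r s : Fin n, r ≠ i → s ≠ i →
      altVar r.castSucc i.castSucc * altVar s.castSucc (Fin.last n) -
        altVar s.castSucc i.castSucc * altVar r.castSucc (Fin.last n) ∈ I)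
    (hD : ∀ f ∈ I, cherryDerivation i f ∈ I) {a k : ℕ} {μ ν : MvPolynomial (OrdPair (n + 1)) ℂ}
    (hμ : CherryTerm i a k μ) (hν : CherryTerm i a k ν) {c : ℂ}
    (h : rename OrdPair.castSucc (cherryContract i μ - c • cherryContract i ν) ∈ I) :
    μ - c • ν ∈ I := by
  obtain ⟨C, hC, hCI⟩ := exists_iterate_derivation_sub_mem hex hD k a
  have h1 := iterate_derivation_mem hD k h
  rw [map_sub, map_smul, iterate_derivation_sub_smul] at h1
  have h2 := I.mul_mem_left (MvPolynomial.C c) (hCI ν hν)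
  have h3 := I.mul_mem_left (MvPolynomial.C C⁻¹) (add_mem (sub_mem h1 (hCI μ hμ)) h2)
  have h4 : (MvPolynomial.C C⁻¹ * MvPolynomial.C C : MvPolynomial (OrdPair (n + 1)) ℂ) = 1 := by
    rw [← map_mul, inv_mul_cancel₀ hC, map_one]
  convert h3 using 1
  simp only [smul_eq_C_mul]
  linear_combination -(μ - MvPolynomial.C c * ν) * h4

end Polarization

/-- Every monomial is, up to sign, a power of `p_{i,n+1}` times a `CherryTerm`. -/
theorem exists_monomial_eq_pow_mul (i : Fin n) (u : OrdPair (n + 1) →₀ ℕ) :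
    ∃ l a k μ, CherryTerm i a k μ ∧
      monomial u (1 : ℂ) = altVar i.castSucc (Fin.last n) ^ l * μ := by
  have hmul : ∀ p q : MvPolynomial (OrdPair (n + 1)) ℂ,
      (∃ l a k μ, CherryTerm i a k μ ∧ p = altVar i.castSucc (Fin.last n) ^ l * μ) →
      (∃ l a k μ, CherryTerm i a k μ ∧ q = altVar i.castSucc (Fin.last n) ^ l * μ) →
      ∃ l a k μ, CherryTerm i a k μ ∧ p * q = altVar i.castSucc (Fin.last n) ^ l * μ := by
    rintro _ _ ⟨l, a, k, μ, hμ, rfl⟩ ⟨l', a', k', μ', hμ', rfl⟩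
    exact ⟨l + l', a + a', k + k', μ * μ', hμ.mul hμ', by ring⟩
  have hone : ∃ l a k μ, CherryTerm i a k μ ∧ (1 : MvPolynomial (OrdPair (n + 1)) ℂ) =
      altVar i.castSucc (Fin.last n) ^ l * μ := ⟨0, 0, 0, 1, .one, by simp⟩
  have hX : ∀ J, ∃ l a k μ, CherryTerm i a k μ ∧ (X J : MvPolynomial (OrdPair (n + 1)) ℂ) =
      altVar i.castSucc (Fin.last n) ^ l * μ := by
    intro J
    rw [← altVar_ordPair]
    obtain ⟨⟨r, s⟩, hrs⟩ := J
    dsimp only at hrs ⊢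
    induction r using Fin.lastCases with
    | last => exact absurd hrs (Fin.le_last s).not_gt
    | cast r =>
      induction s using Fin.lastCases with
      | last =>
        by_cases hr : r = i
        · exact ⟨1, 0, 0, 1, .one, by rw [hr]; ring⟩
        · exact ⟨0, 0, 1, _, .right r hr .one, by ring⟩
      | cast s =>
        rw [Fin.castSucc_lt_castSucc_iff] at hrs
        by_cases hs : s = i
        · subst hs
          exact ⟨0, 1, 0, _, .left r hrs.ne .one, by ring⟩
        · by_cases hr : r = i
          · subst hr
            exact ⟨0, 1, 0, _, .neg (.left s hs .one), by rw [altVar_swap]; ring⟩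
          · exact ⟨0, 0, 0, _, .other r s hr hs hrs.ne .one, by ring⟩
  induction u using Finsupp.induction_linear with
  | zero => exact hone
  | add u v hu hv =>
    rw [show monomial (u + v) (1 : ℂ) = monomial u 1 * monomial v 1 by simp [monomial_mul]]
    exact hmul _ _ hu hv
  | single J k =>
    rw [← X_pow_eq_monomial]
    induction k with
    | zero => rw [pow_zero]; exact hone
    | succ k ih => rw [pow_succ]; exact hmul _ _ ih (hX J)

variable {j : Fin n} {hij : i ≠ j} {S : IteratedSeq n}

/-- The toric maps before and after the extension agree on a term and its contraction, up to the
replacement of `z_{n+1}` by `z_i`. -/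
theorem CherryTerm.pow_mul_toricHom {a k : ℕ} {μ : MvPolynomial (OrdPair (n + 1)) ℂ}
    (hμ : CherryTerm i a k μ) :
    X (.inl i.val) ^ k * toricHom (.extend i j hij S) μ =
      X (.inl n) ^ k * toricHom S (cherryContract i μ) := by
  induction hμ with
  | one => simp
  | neg _ ih => simp only [map_neg, mul_neg, ih]
  | other r s hr hs hrs _ ih =>
    simp only [map_mul, cherryContract_castSucc, toricHom_altVar, toricCoeff_extend_castSucc,
      Fin.val_castSucc]
    linear_combination (X (.inl r.val) * X (.inl s.val) * toricCoeff S r s) * ih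
  | left r hr _ ih =>
    simp only [map_mul, cherryContract_castSucc, toricHom_altVar, toricCoeff_extend_castSucc,
      Fin.val_castSucc]
    linear_combination (X (.inl r.val) * X (.inl i.val) * toricCoeff S r i) * ih
  | right r hr _ ih =>
    simp only [map_mul, cherryContract_last, toricHom_altVar, toricCoeff_extend_last_of_ne S hr,
      Fin.val_castSucc, Fin.val_last]
    linear_combination (X (.inl n) * X (.inl r.val) * X (.inl i.val) * toricCoeff S r i) * ih

/-- The weight which records the degrees in the variables `z_i`, `z_{n+1}` and in the last
variable of the second kind. -/
def cherryWeight (i : Fin n) : ℕ ⊕ ℕ → ℕ × ℕ × ℕ :=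
  Sum.elim (fun r => if r = i.val then (1, 0, 0) else if r = n then (0, 1, 0) else 0)
    fun m => if m = n then (0, 0, 1) else 0

theorem CherryTerm.isWeightedHomogeneous {a k : ℕ} {μ : MvPolynomial (OrdPair (n + 1)) ℂ}
    (hμ : CherryTerm i a k μ) :
    IsWeightedHomogeneous (cherryWeight i) (toricHom (.extend i j hij S) μ) (a, k, 0) := by
  have hc := isWeightedHomogeneous_toricCoeff S (cherryWeight i)
    (fun m hm => by simp [cherryWeight, hm.ne])
  have hz : ∀ r : Fin n, r ≠ i → IsWeightedHomogeneous (cherryWeight i)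
      (X (.inl r.val) : ToricRing) 0 := by
    intro r hr
    have := isWeightedHomogeneous_X ℂ (cherryWeight i) (.inl r.val)
    rwa [show cherryWeight i (.inl r.val) = 0 by
      simp [cherryWeight, Fin.val_inj, hr, r.2.ne]] at this
  have hi : IsWeightedHomogeneous (cherryWeight i) (X (.inl i.val) : ToricRing) (1, 0, 0) := by
    have := isWeightedHomogeneous_X ℂ (cherryWeight i) (.inl i.val)
    rwa [show cherryWeight i (.inl i.val) = (1, 0, 0) by simp [cherryWeight]] at this
  have hn : IsWeightedHomogeneous (cherryWeight i) (X (.inl n) : ToricRing) (0, 1, 0) := by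
    have := isWeightedHomogeneous_X ℂ (cherryWeight i) (.inl n)
    rwa [show cherryWeight i (.inl n) = (0, 1, 0) by simp [cherryWeight, i.2.ne']] at this
  induction hμ with
  | one => rw [map_one]; exact isWeightedHomogeneous_one _ _
  | neg _ ih => rw [map_neg]; exact ih.neg
  | @other a k μ r s hr hs hrs _ ih =>
    rw [map_mul, toricHom_altVar, toricCoeff_extend_castSucc]
    have h := (((hz r hr).mul (hz s hs)).mul (hc r s)).mul ih
    rwa [add_zero, add_zero, zero_add] at h
  | @left a k μ r hr _ ih =>
    rw [map_mul, toricHom_altVar, toricCoeff_extend_castSucc]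
    have h := (((hz r hr).mul hi).mul (hc r i)).mul ih
    rwa [add_zero, zero_add, add_comm ((1, 0, 0) : ℕ × ℕ × ℕ)] at h
  | @right a k μ r hr _ ih =>
    rw [map_mul, toricHom_altVar, toricCoeff_extend_last_of_ne S hr]
    have h := (((hz r hr).mul hn).mul (hc r i)).mul ih
    rwa [add_zero, zero_add, add_comm ((0, 1, 0) : ℕ × ℕ × ℕ)] at h

theorem isWeightedHomogeneous_toricHom_cherry :
    IsWeightedHomogeneous (cherryWeight i)
      (toricHom (.extend i j hij S) (altVar i.castSucc (Fin.last n))) (1, 1, 1) := by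
  have hc := isWeightedHomogeneous_toricCoeff S (cherryWeight i)
    (fun m hm => by simp [cherryWeight, hm.ne])
  rw [toricHom_altVar, toricCoeff_extend_last_self]
  have h := ((isWeightedHomogeneous_X ℂ (cherryWeight i) (.inl i.val)).mul
    (isWeightedHomogeneous_X ℂ (cherryWeight i) (.inl n))).mul
    ((isWeightedHomogeneous_X ℂ (cherryWeight i) (.inr n)).mul (hc i j))
  have hd : cherryWeight i (.inl i.val) + cherryWeight i (.inl n) +
      (cherryWeight i (.inr n) + 0) = (1, 1, 1) := by
    simp [cherryWeight, i.2.ne']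
  rw [hd] at h
  exact h

end Cherry

section ToricIdeal

/-- On three leaves the toric map is injective. -/
theorem ker_toricHom_base_le (S : List (OrdPair 3)) (hS : IsBirationalSeq (by norm_num) S)
    (I : Ideal (MvPolynomial (OrdPair 3) ℂ)) :
    RingHom.ker (toricHom (.base S hS)) ≤ I := by
  refine ker_le_of_binomial_mem _ (exists_toricHom_X_eq_monomial _) _ fun u v c hc huv => ?_
  have h0 := toricHom_monomial_ne_zero (.base S hS) u
  obtain rfl : u = v := by
    refine eq_of_leafDegree_eq fun t => ?_
    let W : ℕ ⊕ ℕ → ℕ := Sum.elim (fun r => if r = t then 1 else 0) fun _ => 0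
    have hW : ∀ m < 3, W (.inr m) = 0 := fun _ _ => rfl
    have h := isWeightedHomogeneous_unique h0 huv
      (isWeightedHomogeneous_toricHom_monomial (.base S hS) W hW u)
      (isWeightedHomogeneous_toricHom_monomial (.base S hS) W hW v)
    have hsum : ∀ u : OrdPair 3 →₀ ℕ,
        ∑ J ∈ u.support, u J • (W (.inl J.1.1.val) + W (.inl J.1.2.val)) =
        ∑ J, u J * ((if J.1.1.val = t then 1 else 0) + if J.1.2.val = t then 1 else 0) := by
      intro u
      refine Finset.sum_subset (Finset.subset_univ _) fun J _ hJ => ?_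
      rw [Finsupp.notMem_support_iff.mp hJ, zero_smul]
    rw [← hsum, ← hsum, h]
  have h1 : (1 - c) • toricHom (.base S hS) (monomial u 1) = 0 := by
    rw [sub_smul, one_smul, ← huv, sub_self]
  obtain h2 := (smul_eq_zero.mp h1).resolve_right h0
  rw [← sub_eq_zero.mp h2, one_smul, sub_self]
  exact zero_mem _

variable {n : ℕ} {i j : Fin n} {hij : i ≠ j} {S : IteratedSeq n}

variable {Γ : Type*} [AddCommGroup Γ] [LinearOrder Γ]

/-- By the four point condition the third term of the Plücker relation for `i, n + 1, r, s` has higher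
weight than the other two, which form its initial form. -/
theorem IsTreeWeight.exchange_mem {w : OrdPair (n + 1) → Γ}
    (hw : IsTreeWeight (.extend i j hij S) w) (r s : Fin n) (hr : r ≠ i) (hs : s ≠ i) :
    altVar r.castSucc i.castSucc * altVar s.castSucc (Fin.last n) -
      altVar s.castSucc i.castSucc * altVar r.castSucc (Fin.last n) ∈
        initIdeal (Finsupp.weight w) (pluckerIdeal (n + 1)) := by
  obtain ⟨-, ⟨a, ha⟩, hlt⟩ := hw
  by_cases hrs : r = s
  · rw [hrs, sub_self]
    exact zero_mem _
  have hom := isWeightedHomogeneous_altVar w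
  refine mem_initIdeal_of_add_mem
    (γ := symWeight w r.castSucc i.castSucc + symWeight w s.castSucc (Fin.last n))
    (h := -(altVar i.castSucc (Fin.last n) * altVar r.castSucc s.castSucc)) ?_ ?_ ?_
  · refine ((hom _ _).mul (hom _ _)).sub ?_
    have hsum : symWeight w r.castSucc i.castSucc + symWeight w s.castSucc (Fin.last n) =
        symWeight w s.castSucc i.castSucc + symWeight w r.castSucc (Fin.last n) := by
      rw [ha s hs, ha r hr]
      abel
    rw [hsum]
    exact (hom s.castSucc i.castSucc).mul (hom r.castSucc (Fin.last n))
  · rw [mem_aboveWeight]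
    intro m hm
    rw [((hom _ _).mul (hom _ _)).neg hm]
    have := hlt s r hs hr (Ne.symm hrs)
    rwa [symWeight_comm w i.castSucc r.castSucc, symWeight_comm w s.castSucc r.castSucc,
      add_comm] at this
  · convert neg_mem (plucker_relation_mem i.castSucc (Fin.last n) r.castSucc s.castSucc) using 1
    rw [altVar_swap i.castSucc r.castSucc, altVar_swap i.castSucc s.castSucc,
      altVar_swap (Fin.last n) s.castSucc, altVar_swap (Fin.last n) r.castSucc]
    ring

variable [IsOrderedAddMonoid Γ]

/-- The derivation which replaces `i` by `n + 1` shifts the weight by the constant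
`w_{r,n+1} - w_{ri}`. -/
theorem IsTreeWeight.derivation_mem {w : OrdPair (n + 1) → Γ}
    (hw : IsTreeWeight (.extend i j hij S) w) (f : MvPolynomial (OrdPair (n + 1)) ℂ)
    (hf : f ∈ initIdeal (Finsupp.weight w) (pluckerIdeal (n + 1))) :
    cherryDerivation i f ∈ initIdeal (Finsupp.weight w) (pluckerIdeal (n + 1)) := by
  obtain ⟨-, ⟨a, ha⟩, -⟩ := hw
  refine derivation_mem_initIdeal a _ ?_ (rowDerivation_mem_pluckerIdeal _ _) hf
  have key : ∀ r s, r ≠ s → IsWeightedHomogeneous w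
      (if s = i.castSucc then altVar r (Fin.last n) else 0) (symWeight w r s + a) := by
    intro r s hrs
    split_ifs with h
    · subst h
      induction r using Fin.lastCases with
      | last => rw [altVar_self]; exact isWeightedHomogeneous_zero _ _ _
      | cast r =>
        rw [add_comm _ a, ← ha r (by simpa using hrs)]
        exact isWeightedHomogeneous_altVar w _ _
    · exact isWeightedHomogeneous_zero _ _ _
  intro J
  rw [← altVar_ordPair, rowDerivation_altVar, ← symWeight_ordPair w J]
  refine IsWeightedHomogeneous.add ?_ (key _ _ J.2.ne)
  have h := key _ _ J.2.ne'
  rw [symWeight_comm] at h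
  have hneg := h.neg
  rwa [show -(if J.1.1 = i.castSucc then altVar J.1.2 (Fin.last n) else 0) =
      if J.1.1 = i.castSucc then altVar (Fin.last n) J.1.2 else 0 by
    split_ifs
    · rw [← altVar_swap]
    · rw [neg_zero]] at hneg

/-- The initial ideal for fewer leaves is contained in the one for more leaves. -/
theorem rename_mem_initIdeal (w : OrdPair (n + 1) → Γ) {f : MvPolynomial (OrdPair n) ℂ}
    (hf : f ∈ initIdeal (Finsupp.weight fun J : OrdPair n => w J.castSucc) (pluckerIdeal n)) :
    rename OrdPair.castSucc f ∈ initIdeal (Finsupp.weight w) (pluckerIdeal (n + 1)) := by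
  refine initIdeal_map_le (rename OrdPair.castSucc) (fun u => ?_) rename_mem_pluckerIdeal hf
  rw [rename_monomial]
  refine isWeightedHomogeneous_monomial _ _ _ ?_
  rw [Finsupp.weight_apply, Finsupp.weight_apply, Finsupp.sum_mapDomain_index]
  · exact fun _ => zero_smul _ _
  · exact fun _ _ _ => add_smul _ _ _

/-- The toric ideal is contained in the initial ideal of the Plücker ideal for a tree weight. -/
theorem IsTreeWeight.ker_toricHom_le {n : ℕ} {S : IteratedSeq n} {w : OrdPair n → Γ}
    (hw : IsTreeWeight S w) :
    RingHom.ker (toricHom S) ≤ initIdeal (Finsupp.weight w) (pluckerIdeal n) := by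
  induction S with
  | base S hS => exact ker_toricHom_base_le S hS _
  | @extend n i j hij S ih =>
    refine ker_le_of_binomial_mem _ (exists_toricHom_X_eq_monomial _) _ fun u v c hc huv => ?_
    have h0 := toricHom_monomial_ne_zero (.extend i j hij S) u
    obtain ⟨l, a, k, μ, hμ, hu⟩ := exists_monomial_eq_pow_mul i u
    obtain ⟨l', a', k', ν, hν, hv⟩ := exists_monomial_eq_pow_mul i v
    rw [hu, hv] at huv ⊢
    rw [hu] at h0
    have hom : ∀ {a k : ℕ} {μ : MvPolynomial (OrdPair (n + 1)) ℂ} (l : ℕ), CherryTerm i a k μ →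
        IsWeightedHomogeneous (cherryWeight i) (toricHom (.extend i j hij S)
          (altVar i.castSucc (Fin.last n) ^ l * μ)) (l • (1, 1, 1) + (a, k, 0)) := by
      intro a k μ l hμ
      rw [map_mul, map_pow]
      exact (isWeightedHomogeneous_toricHom_cherry.pow l).mul hμ.isWeightedHomogeneous
    -- both terms of the binomial contain the same power of `p_{i,n+1}` and have the same degrees
    have hdeg := isWeightedHomogeneous_unique h0 huv (hom l hμ) (hom l' hν)
    simp only [Prod.smul_mk, smul_eq_mul, mul_one, Prod.mk_add_mk, add_zero, Prod.mk.injEq] at hdeg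
    obtain ⟨h1, h2, rfl⟩ := hdeg
    obtain rfl : a = a' := by omega
    obtain rfl : k = k' := by omega
    rw [← mul_smul_comm, ← mul_sub]
    refine Ideal.mul_mem_left _ _ (hμ.sub_smul_mem hw.exchange_mem hw.derivation_mem hν ?_)
    have hμν : toricHom (.extend i j hij S) μ = c • toricHom (.extend i j hij S) ν := by
      rw [map_mul, map_mul, ← mul_smul_comm] at huv
      refine mul_left_cancel₀ ?_ huv
      rw [map_mul] at h0
      exact left_ne_zero_of_mul h0
    refine rename_mem_initIdeal w (ih hw.1 ?_)
    rw [RingHom.mem_ker, map_sub, map_smul, sub_eq_zero]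
    have hz : (X (.inl n) : ToricRing) ^ k ≠ 0 := pow_ne_zero k (X_ne_zero _)
    refine mul_left_cancel₀ hz ?_
    rw [mul_smul_comm, ← hμ.pow_mul_toricHom (hij := hij), ← hν.pow_mul_toricHom (hij := hij),
      hμν, mul_smul_comm]

end ToricIdeal

/-! ### Points over Hahn series and the reverse inclusion -/

section Hahn

variable {Γ R : Type*} [LinearOrder Γ] [CommRing R]

/-- The Hahn series `P` has no terms below `γ`, and its coefficient at `γ` is `c` (which may be
zero). -/
def HasLeadingTerm (P : HahnSeries Γ R) (γ : Γ) (c : R) : Prop :=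
  (∀ δ < γ, P.coeff δ = 0) ∧ P.coeff γ = c

theorem HasLeadingTerm.neg {P : HahnSeries Γ R} {γ : Γ} {c : R} (h : HasLeadingTerm P γ c) :
    HasLeadingTerm (-P) γ (-c) :=
  ⟨fun δ hδ => by rw [HahnSeries.coeff_neg, h.1 δ hδ, neg_zero], by rw [HahnSeries.coeff_neg, h.2]⟩

theorem HasLeadingTerm.add_of_lt {P Q : HahnSeries Γ R} {γ δ : Γ} {c d : R}
    (hP : HasLeadingTerm P γ c) (hQ : HasLeadingTerm Q δ d) (h : γ < δ) :
    HasLeadingTerm (P + Q) γ c :=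
  ⟨fun ε hε => by rw [HahnSeries.coeff_add, hP.1 ε hε, hQ.1 ε (hε.trans h), add_zero],
    by rw [HahnSeries.coeff_add, hP.2, hQ.1 γ h, add_zero]⟩

theorem hasLeadingTerm_single (γ : Γ) (c : R) :
    HasLeadingTerm (HahnSeries.single γ c) γ c :=
  ⟨fun _ hδ => HahnSeries.coeff_single_of_ne hδ.ne, HahnSeries.coeff_single_same γ c⟩

variable [AddCommGroup Γ]

theorem hasLeadingTerm_one [IsOrderedAddMonoid Γ] : HasLeadingTerm (1 : HahnSeries Γ R) 0 1 :=
  hasLeadingTerm_single 0 1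

variable [IsOrderedAddMonoid Γ]

theorem HasLeadingTerm.mul {P Q : HahnSeries Γ R} {γ δ : Γ} {c d : R}
    (hP : HasLeadingTerm P γ c) (hQ : HasLeadingTerm Q δ d) :
    HasLeadingTerm (P * Q) (γ + δ) (c * d) := by
  have hP' : ∀ α ∈ P.support, γ ≤ α := fun α hα => not_lt.mp fun h => hα (hP.1 α h)
  have hQ' : ∀ α ∈ Q.support, δ ≤ α := fun α hα => not_lt.mp fun h => hα (hQ.1 α h)
  constructor
  · intro ε hε
    rw [HahnSeries.coeff_mul]
    refine Finset.sum_eq_zero fun p hp => ?_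
    rw [Finset.mem_antidiagonal] at hp
    have := add_le_add (hP' _ hp.1) (hQ' _ hp.2.1)
    rw [hp.2.2] at this
    exact absurd hε this.not_gt
  · rw [HahnSeries.coeff_mul, Finset.sum_eq_single (γ, δ), hP.2, hQ.2]
    · rintro ⟨α, β⟩ hp hne
      rw [Finset.mem_antidiagonal] at hp
      obtain ⟨hα, hβ, hαβ⟩ := hp
      dsimp only at hα hβ hαβ
      have h1 := hP' _ hα
      have h2 := hQ' _ hβ
      have h3 : α = γ := by
        refine le_antisymm ?_ h1
        by_contra h
        exact absurd hαβ (add_lt_add_of_lt_of_le (not_le.mp h) h2).ne'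
      subst h3
      exact absurd (by rw [add_left_cancel hαβ]) hne
    · intro hp
      rw [Finset.mem_antidiagonal] at hp
      by_cases h1 : P.coeff γ = 0
      · rw [h1, zero_mul]
      · by_cases h2 : Q.coeff δ = 0
        · rw [h2, mul_zero]
        · exact absurd ⟨h1, h2, rfl⟩ hp

theorem HasLeadingTerm.pow {P : HahnSeries Γ R} {γ : Γ} {c : R} (h : HasLeadingTerm P γ c)
    (k : ℕ) : HasLeadingTerm (P ^ k) (k • γ) (c ^ k) := by
  induction k with
  | zero => simpa using hasLeadingTerm_one
  | succ k ih =>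
    rw [pow_succ, pow_succ, succ_nsmul]
    exact ih.mul h

theorem HasLeadingTerm.prod {ι : Type*} (s : Finset ι) {P : ι → HahnSeries Γ R} {γ : ι → Γ}
    {c : ι → R} (h : ∀ j ∈ s, HasLeadingTerm (P j) (γ j) (c j)) :
    HasLeadingTerm (∏ j ∈ s, P j) (∑ j ∈ s, γ j) (∏ j ∈ s, c j) := by
  classical
  induction s using Finset.induction_on with
  | empty => simpa using hasLeadingTerm_one
  | insert a s ha ih =>
    rw [Finset.prod_insert ha, Finset.sum_insert ha, Finset.prod_insert ha]
    exact (h a (Finset.mem_insert_self _ _)).mul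
      (ih fun j hj => h j (Finset.mem_insert_of_mem hj))

/-- If `f` vanishes at a point whose coordinates have leading terms `c_j t^{w_j}`, then the initial
form of `f` with respect to `w` vanishes at `c`. -/
theorem aeval_initForm_eq_zero {σ : Type*} [Algebra ℂ R] {w : σ → Γ} {P : σ → HahnSeries Γ R}
    {c : σ → R} (hP : ∀ j, HasLeadingTerm (P j) (w j) (c j)) {f : MvPolynomial σ ℂ}
    (hf : aeval P f = 0) : aeval c (initForm (Finsupp.weight w) f) = 0 := by
  by_cases hf0 : f = 0
  · rw [hf0, initForm_zero, map_zero]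
  obtain ⟨γ, h, hh, hg, hfe⟩ := exists_initForm_add w hf0
  rw [mem_aboveWeight] at hh
  have hmon : ∀ u, HasLeadingTerm (aeval P (monomial u (1 : ℂ))) (Finsupp.weight w u)
      (aeval c (monomial u (1 : ℂ))) := by
    intro u
    rw [algHom_monomial, algHom_monomial, Finsupp.weight_apply, Finsupp.sum]
    simp only [aeval_X]
    exact HasLeadingTerm.prod _ fun j _ => (hP j).pow _
  have hexp : ∀ g : MvPolynomial σ ℂ, (aeval P g).coeff γ =
      ∑ u ∈ g.support, coeff u g • (aeval P (monomial u (1 : ℂ))).coeff γ := by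
    intro g
    conv_lhs => rw [g.as_sum, map_sum, HahnSeries.coeff_sum]
    refine Finset.sum_congr rfl fun u _ => ?_
    rw [← HahnSeries.coeff_smul, ← map_smul, smul_monomial, smul_eq_mul, mul_one]
  have h1 : (aeval P h).coeff γ = 0 := by
    rw [hexp]
    refine Finset.sum_eq_zero fun u hu => ?_
    rw [(hmon u).1 γ (hh u (mem_support_iff.mp hu)), smul_zero]
  have h2 : (aeval P (initForm (Finsupp.weight w) f)).coeff γ =
      aeval c (initForm (Finsupp.weight w) f) := by
    rw [hexp]
    conv_rhs => rw [(initForm (Finsupp.weight w) f).as_sum, map_sum]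
    refine Finset.sum_congr rfl fun u hu => ?_
    rw [← hg (mem_support_iff.mp hu), (hmon u).2, ← map_smul, smul_monomial, smul_eq_mul, mul_one]
  rw [← h2]
  have h3 := congrArg (fun Q => (aeval P Q).coeff γ) hfe
  simp only [map_add, HahnSeries.coeff_add, h1, add_zero, hf, HahnSeries.coeff_zero] at h3
  exact h3.symm

end Hahn

section Points

variable {Γ : Type*} [AddCommGroup Γ] [LinearOrder Γ] [IsOrderedAddMonoid Γ]

/-- The minors `x_{r1} x_{s2} - x_{r2} x_{s1}` of an `n × 2` matrix. -/
def rowMinor {n : ℕ} {R : Type*} [CommRing R] (x : Fin n → Fin 2 → R) (r s : Fin n) : R :=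
  x r 0 * x s 1 - x r 1 * x s 0

/-- Every tree weight is the vector of orders of the minors of a matrix over Hahn series, with
leading coefficients the toric parameters. At an extension the new row is
`x_{n+1} = t^a x_i + y t^b x_j`. -/
theorem IsTreeWeight.exists_rows {n : ℕ} {S : IteratedSeq n} {w : OrdPair n → Γ}
    (hw : IsTreeWeight S w) : ∃ x : Fin n → Fin 2 → HahnSeries Γ ToricRing,
      ∀ r s, r ≠ s → HasLeadingTerm (rowMinor x r s) (symWeight w r s) (toricCoeff S r s) := by
  have hswap : ∀ {n : ℕ} {S : IteratedSeq n} {w : OrdPair n → Γ}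
      {x : Fin n → Fin 2 → HahnSeries Γ ToricRing} (r s : Fin n),
      HasLeadingTerm (rowMinor x r s) (symWeight w r s) (toricCoeff S r s) →
      HasLeadingTerm (rowMinor x s r) (symWeight w s r) (toricCoeff S s r) := by
    intro n S w x r s h
    rw [symWeight_comm, toricCoeff_swap, show rowMinor x s r = -rowMinor x r s by
      rw [rowMinor, rowMinor]; ring]
    exact h.neg
  induction S with
  | base S hS =>
    let T : Γ → HahnSeries Γ ToricRing := fun γ => HahnSeries.single γ 1
    -- a matrix with minors `t^{w_{01}}`, `t^{w_{02}}`, `t^{w_{12}}`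
    refine ⟨![![1, 0], ![0, T (symWeight w 0 1)],
      ![-T (symWeight w 1 2 - symWeight w 0 1), T (symWeight w 0 2)]], ?_⟩
    have hT : ∀ γ, HasLeadingTerm (T γ) γ 1 := fun γ => hasLeadingTerm_single γ 1
    have key : ∀ r s : Fin 3, r < s → HasLeadingTerm (rowMinor ![![1, 0],
        ![0, T (symWeight w 0 1)], ![-T (symWeight w 1 2 - symWeight w 0 1), T (symWeight w 0 2)]]
        r s) (symWeight w r s) (toricCoeff (.base S hS) r s) := by
      intro r s hrs
      rw [show toricCoeff (.base S hS) r s = 1 by simp [toricCoeff, hrs]]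
      fin_cases r <;> fin_cases s <;> simp [rowMinor] at hrs ⊢
      · exact hT _
      · exact hT _
      · have := (hT (symWeight w 0 1)).mul (hT (symWeight w 1 2 - symWeight w 0 1))
        rwa [add_sub_cancel, mul_one] at this
    intro r s hrs
    rcases hrs.lt_or_gt with h | h
    · exact key r s h
    · exact hswap _ _ (key s r h)
  | @extend n i j hij S ih =>
    obtain ⟨hw', ⟨a, ha⟩, hlt⟩ := hw
    obtain ⟨x, hx⟩ := ih hw'
    simp only [symWeight_castSucc] at hx
    -- chosen so that `y t^b x_j` gives the minor with the row `i` its order `w_{i,n+1}`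
    set b := symWeight w i.castSucc (Fin.last n) - symWeight w i.castSucc j.castSucc with hb
    let x' : Fin (n + 1) → Fin 2 → HahnSeries Γ ToricRing :=
      Fin.snoc x fun c => HahnSeries.single a 1 * x i c + HahnSeries.single b (X (.inr n)) * x j c
    have hold : ∀ r s : Fin n, rowMinor x' r.castSucc s.castSucc = rowMinor x r s := by
      intro r s
      simp [rowMinor, x']
    have hnew : ∀ r : Fin n, rowMinor x' r.castSucc (Fin.last n) =
        HahnSeries.single a 1 * rowMinor x r i +
          HahnSeries.single b (X (.inr n)) * rowMinor x r j := by
      intro r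
      simp only [rowMinor, x', Fin.snoc_castSucc, Fin.snoc_last]
      ring
    have hself : ∀ r, rowMinor x r r = 0 := fun r => by rw [rowMinor]; ring
    have hlast : ∀ r : Fin n, HasLeadingTerm (rowMinor x' r.castSucc (Fin.last n))
        (symWeight w r.castSucc (Fin.last n))
        (toricCoeff (.extend i j hij S) r.castSucc (Fin.last n)) := by
      intro r
      rw [hnew]
      by_cases hr : r = i
      · subst hr
        rw [hself, mul_zero, zero_add, toricCoeff_extend_last_self]
        have := (hasLeadingTerm_single b (X (.inr n) : ToricRing)).mul (hx r j hij)
        rwa [hb, sub_add_cancel] at this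
      · rw [toricCoeff_extend_last_of_ne S hr]
        have h1 := (hasLeadingTerm_single a (1 : ToricRing)).mul (hx r i hr)
        rw [one_mul, ← ha r hr] at h1
        by_cases hrj : r = j
        · rw [hrj] at h1 ⊢
          rwa [hself, mul_zero, add_zero]
        · have h2 := (hasLeadingTerm_single b (X (.inr n) : ToricRing)).mul (hx r j hrj)
          refine h1.add_of_lt h2 ?_
          have := hlt r j hr (Ne.symm hij) hrj
          rw [hb, sub_add_eq_add_sub]
          exact lt_sub_iff_add_lt.mpr this
    refine ⟨x', fun r s hrs => ?_⟩
    induction r using Fin.lastCases with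
    | last =>
      induction s using Fin.lastCases with
      | last => exact absurd rfl hrs
      | cast s => exact hswap _ _ (hlast s)
    | cast r =>
      induction s using Fin.lastCases with
      | last => exact hlast r
      | cast s =>
        rw [hold, toricCoeff_extend_castSucc]
        exact hx r s (by simpa using hrs)

/-- The rows of the matrix are rescaled by the variables `z_r`, and the resulting generic point of the
toric variety is the leading term of a point of the Grassmannian. -/
theorem IsTreeWeight.initIdeal_le {n : ℕ} {S : IteratedSeq n} {w : OrdPair n → Γ}
    (hw : IsTreeWeight S w) :
    initIdeal (Finsupp.weight w) (pluckerIdeal n) ≤ RingHom.ker (toricHom S) := by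
  obtain ⟨x, hx⟩ := hw.exists_rows
  let z : Fin n → HahnSeries Γ ToricRing := fun r => HahnSeries.single 0 (X (.inl r.val))
  refine Ideal.span_le.mpr ?_
  rintro _ ⟨f, hf, rfl⟩
  have hf0 : minorHom (fun r c => z r * x r c) f = 0 := minorHom_eq_zero _ f hf
  refine aeval_initForm_eq_zero (fun J => ?_) hf0
  have h := ((hasLeadingTerm_single (0 : Γ) (X (.inl J.1.1.val) : ToricRing)).mul
    (hasLeadingTerm_single (0 : Γ) (X (.inl J.1.2.val) : ToricRing))).mul
    (hx J.1.1 J.1.2 J.2.ne)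
  rw [add_zero, zero_add, symWeight_ordPair] at h
  convert h using 1
  · rw [rowMinor]
    ring
  · rw [toricTerm]

/-- The initial ideal of the Plücker ideal for a tree weight is the toric ideal. -/
theorem IsTreeWeight.initIdeal_eq {n : ℕ} {S : IteratedSeq n} {w : OrdPair n → Γ}
    (hw : IsTreeWeight S w) :
    initIdeal (Finsupp.weight w) (pluckerIdeal n) = RingHom.ker (toricHom S) :=
  le_antisymm hw.initIdeal_le hw.ker_toricHom_le

end Points

/-! ### Paths in the tree of an iterated sequence -/

namespace TrivalentTree

variable {n : ℕ} (T : TrivalentTree n)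

theorem pathEdges_eq_of_isPath {r s : Fin n} (p : T.graph.Walk (.inl r) (.inl s)) (hp : p.IsPath) :
    T.pathEdges r s = {e | e ∈ p.edges} := by
  ext e
  constructor
  · rintro ⟨q, hq, he⟩
    have := (T.isTree.isAcyclic.subsingleton_path _ _).elim ⟨p, hp⟩ ⟨q, hq⟩
    rw [Subtype.mk.injEq] at this
    rwa [← this] at he
  · exact fun he => ⟨p, hp, he⟩

theorem exists_isPath (r s : Fin n) : ∃ p : T.graph.Walk (.inl r) (.inl s), p.IsPath :=
  (T.isTree.existsUnique_path _ _).exists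

theorem pathEdges_comm (r s : Fin n) : T.pathEdges r s = T.pathEdges s r := by
  obtain ⟨p, hp⟩ := T.exists_isPath r s
  rw [T.pathEdges_eq_of_isPath p hp, T.pathEdges_eq_of_isPath p.reverse hp.reverse]
  simp

theorem pathEdges_subset_edgeSet (r s : Fin n) : T.pathEdges r s ⊆ T.graph.edgeSet := by
  rintro e ⟨p, -, he⟩
  exact p.edges_subset_edgeSet he

theorem pathEdges_subset_union (r i s : Fin n) :
    T.pathEdges r s ⊆ T.pathEdges r i ∪ T.pathEdges i s := by
  classical
  obtain ⟨p, hp⟩ := T.exists_isPath r i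
  obtain ⟨q, hq⟩ := T.exists_isPath i s
  rw [T.pathEdges_eq_of_isPath p hp, T.pathEdges_eq_of_isPath q hq,
    T.pathEdges_eq_of_isPath _ (p.append q).bypass_isPath]
  intro e he
  have := (p.append q).edges_bypass_subset_edges he
  rwa [SimpleGraph.Walk.edges_append, List.mem_append] at this

/-- A vertex of a path different from both end points has two neighbours. -/
theorem exists_ne_adj_of_mem_support {V : Type*} {G : SimpleGraph V} {u v y : V} (p : G.Walk u v)
    (hp : p.IsPath) (hy : y ∈ p.support) (hu : y ≠ u) (hv : y ≠ v) :
    ∃ a b, a ≠ b ∧ G.Adj y a ∧ G.Adj y b := by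
  induction p with
  | nil => simp at hy; exact absurd hy hu
  | @cons u u' v h p ih =>
    rw [SimpleGraph.Walk.cons_isPath_iff] at hp
    rw [SimpleGraph.Walk.support_cons, List.mem_cons] at hy
    have hy' := hy.resolve_left hu
    by_cases hyu : y = u'
    · subst hyu
      cases p with
      | nil => exact absurd rfl hv
      | @cons _ u'' _ h' p =>
        refine ⟨u, u'', ?_, h.symm, h'⟩
        rintro rfl
        exact hp.2 (by simp)
    · exact ih hp.1 hy' hyu hv

theorem exists_neighborSet_eq (l : Fin n) : ∃ v, T.graph.neighborSet (.inl l) = {v} :=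
  Set.ncard_eq_one.mp (T.leaf_valency l)

/-- The edge with leaf `l`. -/
def leafEdge (l : Fin n) : Sym2 (Fin n ⊕ T.Inner) := s(.inl l, (T.exists_neighborSet_eq l).choose)

theorem eq_leafEdge {l : Fin n} {e : Sym2 (Fin n ⊕ T.Inner)} (he : e ∈ T.graph.edgeSet)
    (hl : .inl l ∈ e) : e = T.leafEdge l := by
  obtain ⟨v, rfl⟩ := Sym2.mem_iff_exists.mp hl
  have hv : v ∈ T.graph.neighborSet (.inl l) := he
  rw [(T.exists_neighborSet_eq l).choose_spec] at hv
  rw [leafEdge, ← Set.mem_singleton_iff.mp hv]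

theorem inl_mem_leafEdge (l : Fin n) : .inl l ∈ T.leafEdge l := Sym2.mem_mk_left _ _

theorem leafEdge_mem_pathEdges_left {r s : Fin n} (hrs : r ≠ s) :
    T.leafEdge r ∈ T.pathEdges r s := by
  obtain ⟨p, hp⟩ := T.exists_isPath r s
  rw [T.pathEdges_eq_of_isPath p hp, Set.mem_ofPred_eq]
  generalize hs : (.inl s : Fin n ⊕ T.Inner) = v at p
  cases p with
  | nil => simp at hs; exact absurd hs.symm hrs
  | @cons _ u _ h p =>
    rw [← T.eq_leafEdge (e := s(.inl r, u)) h (Sym2.mem_mk_left _ _)]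
    simp

theorem leafEdge_mem_pathEdges_right {r s : Fin n} (hrs : r ≠ s) :
    T.leafEdge s ∈ T.pathEdges r s := by
  rw [pathEdges_comm]
  exact T.leafEdge_mem_pathEdges_left hrs.symm

/-- A path between leaves contains no further leaves. -/
theorem eq_or_eq_of_inl_mem {r s l : Fin n} {e : Sym2 (Fin n ⊕ T.Inner)}
    (he : e ∈ T.pathEdges r s) (hl : .inl l ∈ e) : l = r ∨ l = s := by
  by_contra! h
  obtain ⟨p, hp, he⟩ := he
  obtain ⟨v, rfl⟩ := Sym2.mem_iff_exists.mp hl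
  obtain ⟨a, b, hab, ha, hb⟩ := exists_ne_adj_of_mem_support p hp (p.fst_mem_support_of_mem_edges he)
    (by simpa using h.1) (by simpa using h.2)
  obtain ⟨x, hx⟩ := T.exists_neighborSet_eq l
  have ha' : a ∈ T.graph.neighborSet (.inl l) := ha
  have hb' : b ∈ T.graph.neighborSet (.inl l) := hb
  rw [hx, Set.mem_singleton_iff] at ha' hb'
  exact hab (ha'.trans hb'.symm)

theorem mem_internalEdges_or_exists_leaf {e : Sym2 (Fin n ⊕ T.Inner)} (he : e ∈ T.graph.edgeSet) :
    e ∈ T.internalEdges ∨ ∃ l, .inl l ∈ e := by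
  induction e using Sym2.ind with
  | _ a b =>
    rcases a with l | a
    · exact Or.inr ⟨l, Sym2.mem_mk_left _ _⟩
    · rcases b with l | b
      · exact Or.inr ⟨l, Sym2.mem_mk_right _ _⟩
      · exact Or.inl ⟨he, a, b, rfl⟩

theorem inl_notMem_of_mem_internalEdges {e : Sym2 (Fin n ⊕ T.Inner)} (he : e ∈ T.internalEdges)
    (l : Fin n) : .inl l ∉ e := by
  obtain ⟨-, a, b, rfl⟩ := he
  simp

theorem pathEdges_eq {r s : Fin n} (hrs : r ≠ s) : T.pathEdges r s =
    insert (T.leafEdge r) (insert (T.leafEdge s) (T.pathEdges r s ∩ T.internalEdges)) := by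
  ext e
  simp only [Set.mem_insert_iff, Set.mem_inter_iff]
  constructor
  · intro he
    have hE := T.pathEdges_subset_edgeSet r s he
    rcases T.mem_internalEdges_or_exists_leaf hE with h | ⟨l, hl⟩
    · exact Or.inr (Or.inr ⟨he, h⟩)
    · rcases T.eq_or_eq_of_inl_mem he hl with rfl | rfl
      · exact Or.inl (T.eq_leafEdge hE hl)
      · exact Or.inr (Or.inl (T.eq_leafEdge hE hl))
  · rintro (rfl | rfl | h)
    · exact T.leafEdge_mem_pathEdges_left hrs
    · exact T.leafEdge_mem_pathEdges_right hrs
    · exact h.1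

/-- The length of the part of the path from `r` to `s` which consists of internal edges. -/
def innerDist (len : Sym2 (Fin n ⊕ T.Inner) → ℝ) (r s : Fin n) : ℝ :=
  ∑ᶠ e ∈ T.pathEdges r s ∩ T.internalEdges, len e

theorem innerDist_comm (len : Sym2 (Fin n ⊕ T.Inner) → ℝ) (r s : Fin n) :
    T.innerDist len r s = T.innerDist len s r := by
  rw [innerDist, innerDist, pathEdges_comm]

theorem innerDist_triangle {len : Sym2 (Fin n ⊕ T.Inner) → ℝ}
    (hlen : ∀ e ∈ T.internalEdges, 0 ≤ len e) (r i s : Fin n) :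
    T.innerDist len r s ≤ T.innerDist len r i + T.innerDist len i s := by
  classical
  have := Fintype.ofFinite T.Inner
  simp only [innerDist]
  rw [finsum_mem_eq_finite_toFinset_sum _ (Set.toFinite _),
    finsum_mem_eq_finite_toFinset_sum _ (Set.toFinite _),
    finsum_mem_eq_finite_toFinset_sum _ (Set.toFinite _), ← Finset.sum_union_inter]
  have hpos : ∀ r s, ∀ e ∈ (Set.toFinite (T.pathEdges r s ∩ T.internalEdges)).toFinset,
      0 ≤ len e := fun r s e he => hlen e ((Set.Finite.mem_toFinset _).mp he).2
  refine le_add_of_le_of_nonneg (Finset.sum_le_sum_of_subset_of_nonneg ?_ ?_) ?_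
  · intro e he
    rw [Set.Finite.mem_toFinset] at he
    rw [Finset.mem_union, Set.Finite.mem_toFinset, Set.Finite.mem_toFinset]
    exact (T.pathEdges_subset_union r i s he.1).imp (fun h => ⟨h, he.2⟩) fun h => ⟨h, he.2⟩
  · intro e he _
    rcases Finset.mem_union.mp he with h | h
    · exact hpos _ _ e h
    · exact hpos _ _ e h
  · exact Finset.sum_nonneg fun e he => hpos _ _ e (Finset.mem_inter.mp he).1

/-- No edge connects two leaves. The axioms of a trivalent tree allow a single edge with two leaves,
which has to be excluded. -/
def LeavesNotAdjacent : Prop := ∀ l l', ¬ T.graph.Adj (.inl l) (.inl l')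

variable {T}

theorem LeavesNotAdjacent.leafEdge_ne (hT : T.LeavesNotAdjacent) {r s : Fin n} (hrs : r ≠ s) :
    T.leafEdge r ≠ T.leafEdge s := by
  intro h
  have hE := T.pathEdges_subset_edgeSet r s (T.leafEdge_mem_pathEdges_left hrs)
  have h1 := T.inl_mem_leafEdge r
  have h2 := T.inl_mem_leafEdge s
  rw [← h] at h2
  have := (Sym2.mem_and_mem_iff (by simpa using hrs)).mp ⟨h1, h2⟩
  rw [this] at hE
  exact hT r s hE

theorem LeavesNotAdjacent.finsum_pathEdges (hT : T.LeavesNotAdjacent)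
    (len : Sym2 (Fin n ⊕ T.Inner) → ℝ) {r s : Fin n} (hrs : r ≠ s) :
    ∑ᶠ e ∈ T.pathEdges r s, len e =
      len (T.leafEdge r) + (len (T.leafEdge s) + T.innerDist len r s) := by
  have hni : ∀ l, T.leafEdge l ∉ T.pathEdges r s ∩ T.internalEdges := fun l h =>
    T.inl_notMem_of_mem_internalEdges h.2 l (T.inl_mem_leafEdge l)
  rw [T.pathEdges_eq hrs, finsum_mem_insert _ _ (Set.toFinite _),
    finsum_mem_insert _ (hni s) (Set.toFinite _), innerDist]
  rw [Set.mem_insert_iff, not_or]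
  exact ⟨hT.leafEdge_ne hrs, hni r⟩

/-! ### Attaching a cherry -/

variable (T) (i : Fin n)

theorem cherryGraph_adj_cherryEmb {u v : Fin n ⊕ T.Inner} (h : T.graph.Adj u v) :
    (T.cherryGraph i).Adj (T.cherryEmb i u) (T.cherryEmb i v) :=
  Or.inl (Or.inl ⟨fun h' => h.ne ((T.cherryEmb i).injective h'), u, v, h, rfl, rfl⟩)

/-- The inclusion of `T` in the tree with a cherry attached. -/
def cherryHom : T.graph →g (T.attachCherry i).graph :=
  ⟨T.cherryEmb i, fun h => T.cherryGraph_adj_cherryEmb i h⟩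

/-- The inclusion of the edges of `T` in those of the tree with a cherry attached. -/
def cherryMap : Sym2 (Fin n ⊕ T.Inner) → Sym2 (Fin (n + 1) ⊕ (T.attachCherry i).Inner) :=
  Sym2.map (T.cherryHom i)

theorem cherryMap_injective : Function.Injective (T.cherryMap i) :=
  Sym2.map.injective (T.cherryEmb i).injective

theorem pathEdges_attachCherry {r s : Fin n} (hr : r ≠ i) (hs : s ≠ i) :
    (T.attachCherry i).pathEdges r.castSucc s.castSucc =
      T.cherryMap i '' T.pathEdges r s := by
  obtain ⟨p, hp⟩ := T.exists_isPath r s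
  rw [T.pathEdges_eq_of_isPath p hp]
  have hq := hp.map (f := T.cherryHom i) (T.cherryEmb i).injective
  have hr' : T.cherryHom i (.inl r) = .inl r.castSucc := T.cherryEmb_of_ne hr
  have hs' : T.cherryHom i (.inl s) = .inl s.castSucc := T.cherryEmb_of_ne hs
  rw [(T.attachCherry i).pathEdges_eq_of_isPath ((p.map (T.cherryHom i)).copy hr' hs')
    (by simpa using hq)]
  ext e
  rw [Set.mem_ofPred_eq, SimpleGraph.Walk.edges_copy, SimpleGraph.Walk.edges_map, List.mem_map]
  rfl

theorem pathEdges_attachCherry_cherry {r : Fin n} (hr : r ≠ i) {x : Fin (n + 1)}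
    (hx : x = i.castSucc ∨ x = Fin.last n) :
    (T.attachCherry i).pathEdges r.castSucc x =
      insert s(.inr none, .inl x) (T.cherryMap i '' T.pathEdges r i) := by
  obtain ⟨p, hp⟩ := T.exists_isPath r i
  rw [T.pathEdges_eq_of_isPath p hp]
  have hq := hp.map (f := T.cherryHom i) (T.cherryEmb i).injective
  have hr' : T.cherryHom i (.inl r) = .inl r.castSucc := T.cherryEmb_of_ne hr
  have hi' : T.cherryHom i (.inl i) = .inr none := T.cherryEmb_self i
  have hadj : (T.attachCherry i).graph.Adj (.inr none) (.inl x) := by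
    have : Sum.inr none ∈ (T.cherryGraph i).neighborSet (.inl x) := by
      rw [T.cherry_neighborSet_leaf i x hx]
      rfl
    exact SimpleGraph.Adj.symm this
  have hpath : (((p.map (T.cherryHom i)).copy hr' hi').concat hadj).IsPath := by
    refine SimpleGraph.Walk.IsPath.concat (by simpa using hq) ?_ hadj
    rw [SimpleGraph.Walk.support_copy, SimpleGraph.Walk.support_map, List.mem_map]
    rintro ⟨v, -, hv⟩
    rcases hx with rfl | rfl
    · exact T.cherryEmb_ne_self i v hv
    · exact T.cherryEmb_ne_last i v hv
  rw [(T.attachCherry i).pathEdges_eq_of_isPath _ hpath]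
  ext e
  rw [Set.mem_ofPred_eq, SimpleGraph.Walk.edges_concat, SimpleGraph.Walk.edges_copy,
    SimpleGraph.Walk.edges_map, List.concat_eq_append, List.mem_append, List.mem_singleton,
    List.mem_map, or_comm]
  rfl

theorem pathEdges_attachCherry_self :
    (T.attachCherry i).pathEdges i.castSucc (Fin.last n) =
      {s(.inl i.castSucc, .inr none), s(.inr none, .inl (Fin.last n))} := by
  have h : ∀ x, (x = i.castSucc ∨ x = Fin.last n) →
      (T.attachCherry i).graph.Adj (.inl x) (.inr none) := by
    intro x hx
    have : Sum.inr none ∈ (T.cherryGraph i).neighborSet (.inl x) := by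
      rw [T.cherry_neighborSet_leaf i x hx]
      rfl
    exact this
  rw [(T.attachCherry i).pathEdges_eq_of_isPath
    (.cons (h _ (Or.inl rfl)) (.cons (h _ (Or.inr rfl)).symm .nil))
    (by simp [SimpleGraph.Walk.cons_isPath_iff, Fin.castSucc_ne_last])]
  ext e
  simp

variable {T i}

/-- The internal edges after attaching a cherry at `i` which come from edges of `T` are the internal
ones and the edge with leaf `i`. -/
theorem LeavesNotAdjacent.map_mem_internalEdges_iff (hT : T.LeavesNotAdjacent)
    {e : Sym2 (Fin n ⊕ T.Inner)} (he : e ∈ T.graph.edgeSet) :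
    T.cherryMap i e ∈ (T.attachCherry i).internalEdges ↔
      e ∈ T.internalEdges ∨ .inl i ∈ e := by
  have hE : T.cherryMap i e ∈ (T.attachCherry i).graph.edgeSet := by
    induction e using Sym2.ind with
    | _ a b => exact T.cherryGraph_adj_cherryEmb i he
  constructor
  · intro h
    refine (T.mem_internalEdges_or_exists_leaf he).imp_right ?_
    rintro ⟨l, hl⟩
    by_cases hli : l = i
    · rwa [← hli]
    · exact absurd (Sym2.mem_map.mpr ⟨_, hl, T.cherryEmb_of_ne hli⟩)
        ((T.attachCherry i).inl_notMem_of_mem_internalEdges h l.castSucc)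
  · intro h
    refine ((T.attachCherry i).mem_internalEdges_or_exists_leaf hE).resolve_right ?_
    rintro ⟨x, hx⟩
    obtain ⟨v, hv, hvx⟩ := Sym2.mem_map.mp hx
    change T.cherryEmb i v = _ at hvx
    rcases v with l | c
    · rcases h with h | h
      · exact T.inl_notMem_of_mem_internalEdges h l hv
      · by_cases hli : l = i
        · rw [hli, T.cherryEmb_self] at hvx
          simp at hvx
        · have := (Sym2.mem_and_mem_iff (by simpa using hli)).mp ⟨hv, h⟩
          rw [this] at he
          exact hT l i he
    · rw [T.cherryEmb_inner] at hvx
      simp at hvx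

theorem LeavesNotAdjacent.attachCherry (hT : T.LeavesNotAdjacent) :
    (T.attachCherry i).LeavesNotAdjacent := by
  intro l l' h
  have h' : Sum.inl l' ∈ (T.cherryGraph i).neighborSet (.inl l) := h
  rcases cherry_cases T i (.inl l) with ⟨u, hu⟩ | h1 | h1
  · by_cases hui : u = .inl i
    · rw [hui, cherryEmb_self] at hu
      simp at hu
    · rw [← hu, cherry_neighborSet T i u hui] at h'
      obtain ⟨v, hv, hv'⟩ := h'
      rcases u with u | u
      · rcases v with v | v
        · exact hT u v hv
        · rw [T.cherryEmb_inner] at hv'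
          simp at hv'
      · rw [T.cherryEmb_inner] at hu
        simp at hu
  · rw [cherry_neighborSet_leaf T i l (Or.inl (Sum.inl_injective h1))] at h'
    simp at h'
  · rw [cherry_neighborSet_leaf T i l (Or.inr (Sum.inl_injective h1))] at h'
    simp at h'

variable {len : Sym2 (Fin (n + 1) ⊕ (T.attachCherry i).Inner) → ℝ}

theorem LeavesNotAdjacent.innerDist_attachCherry (hT : T.LeavesNotAdjacent) {r s : Fin n}
    (hr : r ≠ i) (hs : s ≠ i) :
    (T.attachCherry i).innerDist len r.castSucc s.castSucc =
      T.innerDist (len ∘ T.cherryMap i) r s := by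
  have hset : (T.attachCherry i).pathEdges r.castSucc s.castSucc ∩
      (T.attachCherry i).internalEdges =
        T.cherryMap i '' (T.pathEdges r s ∩ T.internalEdges) := by
    rw [T.pathEdges_attachCherry i hr hs]
    ext e
    constructor
    · rintro ⟨⟨e, he, rfl⟩, he'⟩
      rw [hT.map_mem_internalEdges_iff (T.pathEdges_subset_edgeSet r s he)] at he'
      refine ⟨e, ⟨he, he'.resolve_right fun h => ?_⟩, rfl⟩
      rcases T.eq_or_eq_of_inl_mem he h with h | h
      · exact hr h.symm
      · exact hs h.symm
    · rintro ⟨e, ⟨he, he'⟩, rfl⟩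
      exact ⟨⟨e, he, rfl⟩, (hT.map_mem_internalEdges_iff he'.1).mpr (Or.inl he')⟩
  rw [innerDist, hset, finsum_mem_image (T.cherryMap_injective i).injOn]
  rfl

theorem LeavesNotAdjacent.innerDist_attachCherry_cherry (hT : T.LeavesNotAdjacent) {r : Fin n}
    (hr : r ≠ i) {x : Fin (n + 1)} (hx : x = i.castSucc ∨ x = Fin.last n) :
    (T.attachCherry i).innerDist len r.castSucc x =
      len (T.cherryMap i (T.leafEdge i)) +
        T.innerDist (len ∘ T.cherryMap i) r i := by
  have hinj := T.cherryMap_injective i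
  have hset : (T.attachCherry i).pathEdges r.castSucc x ∩ (T.attachCherry i).internalEdges =
      insert (T.cherryMap i (T.leafEdge i))
        (T.cherryMap i '' (T.pathEdges r i ∩ T.internalEdges)) := by
    rw [T.pathEdges_attachCherry_cherry i hr hx]
    ext e
    constructor
    · rintro ⟨rfl | ⟨e, he, rfl⟩, he'⟩
      · exact absurd (Sym2.mem_mk_right _ _)
          ((T.attachCherry i).inl_notMem_of_mem_internalEdges he' x)
      · have hE := T.pathEdges_subset_edgeSet r i he
        rcases (hT.map_mem_internalEdges_iff hE).mp he' with h | h
        · exact Or.inr ⟨e, ⟨he, h⟩, rfl⟩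
        · exact Or.inl (by rw [T.eq_leafEdge hE h])
    · rintro (rfl | ⟨e, ⟨he, he'⟩, rfl⟩)
      · have he := T.leafEdge_mem_pathEdges_right hr
        exact ⟨Or.inr ⟨_, he, rfl⟩, (hT.map_mem_internalEdges_iff
          (T.pathEdges_subset_edgeSet r i he)).mpr (Or.inr (T.inl_mem_leafEdge i))⟩
      · exact ⟨Or.inr ⟨e, he, rfl⟩, (hT.map_mem_internalEdges_iff he'.1).mpr (Or.inl he')⟩
  have : Finite (T.attachCherry i).Inner := (T.attachCherry i).finite_inner
  rw [innerDist, hset, finsum_mem_insert _ _ (Set.toFinite _), finsum_mem_image hinj.injOn]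
  · rfl
  · rintro ⟨e, he, h⟩
    rw [hinj h] at he
    exact T.inl_notMem_of_mem_internalEdges he.2 i (T.inl_mem_leafEdge i)

theorem innerDist_attachCherry_self :
    (T.attachCherry i).innerDist len i.castSucc (Fin.last n) = 0 := by
  rw [innerDist, pathEdges_attachCherry_self]
  convert finsum_mem_empty
  rw [Set.eq_empty_iff_forall_notMem]
  rintro e ⟨rfl | rfl, h⟩
  · exact (T.attachCherry i).inl_notMem_of_mem_internalEdges h _ (Sym2.mem_mk_left _ _)
  · exact (T.attachCherry i).inl_notMem_of_mem_internalEdges h _ (Sym2.mem_mk_right _ _)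

end TrivalentTree

theorem IteratedSeq.leavesNotAdjacent {n : ℕ} (S : IteratedSeq n) : S.tree.LeavesNotAdjacent := by
  induction S with
  | base S hS => intro l l' h; simp [IteratedSeq.tree, tripod] at h
  | extend i j hij S ih => exact ih.attachCherry

/-- Minus a leaf-to-leaf distance with positive lengths on internal edges is a tree weight; the
terms `ρ` account for the edges with leaves. -/
theorem isTreeWeight_of_innerDist {n : ℕ} (S : IteratedSeq n)
    (len : Sym2 (Fin n ⊕ S.tree.Inner) → ℝ) (hlen : ∀ e ∈ S.tree.internalEdges, 0 < len e)
    (ρ : Fin n → ℝ) (w : OrdPair n → ℝ)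
    (hw : ∀ J : OrdPair n, w J = ρ J.1.1 + ρ J.1.2 - S.tree.innerDist len J.1.1 J.1.2) :
    IsTreeWeight S w := by
  induction S with
  | base S hS => trivial
  | @extend n i j hij S ih =>
    have hT := S.leavesNotAdjacent
    obtain ⟨len, hlen, hw⟩ : ∃ len : Sym2 (Fin (n + 1) ⊕ (S.tree.attachCherry i).Inner) → ℝ,
        (∀ e ∈ (S.tree.attachCherry i).internalEdges, 0 < len e) ∧ ∀ J : OrdPair (n + 1),
          w J = ρ J.1.1 + ρ J.1.2 - (S.tree.attachCherry i).innerDist len J.1.1 J.1.2 :=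
      ⟨len, hlen, hw⟩
    have hsym : ∀ r s, r ≠ s → symWeight w r s =
        ρ r + ρ s - (S.tree.attachCherry i).innerDist len r s := by
      intro r s hrs
      rcases hrs.lt_or_gt with h | h
      · have h1 := hw ⟨(r, s), h⟩
        rwa [← symWeight_ordPair w] at h1
      · have h1 := hw ⟨(s, r), h⟩
        rw [← symWeight_ordPair w] at h1
        rw [symWeight_comm, TrivalentTree.innerDist_comm, add_comm (ρ r)]
        exact h1
    have hne : ∀ r : Fin n, r.castSucc ≠ Fin.last n := Fin.castSucc_ne_last
    have hne' : ∀ {r s : Fin n}, r ≠ s → r.castSucc ≠ s.castSucc := fun h => by simpa using h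
    -- the edge with leaf `i` of the old tree is internal in the new tree
    set ε := len (S.tree.cherryMap i (S.tree.leafEdge i))
    have hlen' : ∀ e ∈ S.tree.internalEdges, 0 < (len ∘ S.tree.cherryMap i) e :=
      fun e he => hlen _ ((hT.map_mem_internalEdges_iff he.1).mpr (Or.inl he))
    have hε0 : 0 < ε := hlen _ ((hT.map_mem_internalEdges_iff
      (S.tree.pathEdges_subset_edgeSet i j (S.tree.leafEdge_mem_pathEdges_left hij))).mpr
        (Or.inr (S.tree.inl_mem_leafEdge i)))
    refine ⟨ih (len ∘ S.tree.cherryMap i) hlen'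
      (fun r => ρ r.castSucc - if r = i then ε else 0) _ fun J => ?_,
      ⟨ρ (Fin.last n) - ρ i.castSucc, fun r hr => ?_⟩, fun r s hr hs hrs => ?_⟩
    · obtain ⟨⟨r, s⟩, hrs⟩ := J
      dsimp only at hrs ⊢
      rw [← symWeight_ordPair w]
      change symWeight w r.castSucc s.castSucc = _
      rw [hsym _ _ (hne' hrs.ne)]
      by_cases hr : r = i
      · subst hr
        rw [TrivalentTree.innerDist_comm, S.tree.innerDist_comm,
          hT.innerDist_attachCherry_cherry hrs.ne' (Or.inl rfl), if_pos rfl, if_neg hrs.ne']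
        ring
      · by_cases hs : s = i
        · subst hs
          rw [hT.innerDist_attachCherry_cherry hr (Or.inl rfl), if_pos rfl, if_neg hr]
          ring
        · rw [hT.innerDist_attachCherry hr hs, if_neg hr, if_neg hs]
          ring
    · rw [hsym _ _ (hne r), hsym _ _ (hne' hr), hT.innerDist_attachCherry_cherry hr (Or.inl rfl),
        hT.innerDist_attachCherry_cherry hr (Or.inr rfl)]
      ring
    · rw [hsym _ _ (hne r), hsym _ _ (hne i), hsym _ _ (hne' (Ne.symm hs)), hsym _ _ (hne' hrs),
        TrivalentTree.innerDist_comm _ _ i.castSucc s.castSucc,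
        hT.innerDist_attachCherry_cherry hr (Or.inr rfl),
        hT.innerDist_attachCherry_cherry hs (Or.inl rfl),
        TrivalentTree.innerDist_attachCherry_self, hT.innerDist_attachCherry hr hs]
      have := S.tree.innerDist_triangle (fun e he => (hlen' e he).le) r i s
      rw [S.tree.innerDist_comm _ i s] at this
      linarith

theorem isTreeWeight_weightVector {n : ℕ} (S : IteratedSeq n) :
    IsTreeWeight S S.tree.weightVector := by
  refine isTreeWeight_of_innerDist S (fun _ => 1) (fun _ _ => one_pos) (fun _ => 0) _ fun J => ?_
  rw [TrivalentTree.weightVector, TrivalentTree.innerDist,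
    finsum_mem_eq_finite_toFinset_sum _ (Set.toFinite _), Finset.sum_const,
    Set.ncard_eq_toFinset_card _ (Set.toFinite _)]
  simp

/-- A relative interior point of the cone is a proper convex combination of a point of the cone and the
point with all edge lengths `1`. -/
theorem exists_pos_len_of_mem_intrinsicInterior {n : ℕ} (T : TrivalentTree n)
    {w : OrdPair n → ℝ} (hw : w ∈ intrinsicInterior ℝ T.cone) :
    ∃ len : Sym2 (Fin n ⊕ T.Inner) → ℝ, (∀ e ∈ T.internalEdges, 0 < len e) ∧
      ∀ J : OrdPair n, w J = -∑ᶠ e ∈ T.pathEdges J.1.1 J.1.2, len e := by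
  let w₀ : OrdPair n → ℝ := fun J => -∑ᶠ e ∈ T.pathEdges J.1.1 J.1.2, (1 : ℝ)
  have hw₀ : w₀ ∈ T.cone := ⟨fun _ => 1, fun _ _ => zero_le_one, fun _ => rfl⟩
  have hwc : w ∈ T.cone := intrinsicInterior_subset hw
  -- points slightly beyond `w` on the ray from `w₀` through `w` lie in the cone
  obtain ⟨t, ht, htc⟩ : ∃ t : ℝ, 1 < t ∧ AffineMap.lineMap w₀ w t ∈ T.cone := by
    obtain ⟨y, hy, rfl⟩ := mem_intrinsicInterior.mp hw
    let g : ℝ → affineSpan ℝ T.cone := fun t => ⟨AffineMap.lineMap w₀ (y : OrdPair n → ℝ) t,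
      AffineMap.lineMap_mem t (subset_affineSpan ℝ _ hw₀) y.2⟩
    have hg : Continuous g := by
      refine Continuous.subtype_mk ?_ _
      exact AffineMap.lineMap_continuous
    have hg1 : g 1 = y := Subtype.ext (AffineMap.lineMap_apply_one _ _)
    have hnhds : g ⁻¹' ((↑) ⁻¹' T.cone) ∈ nhds (1 : ℝ) :=
      hg.continuousAt.preimage_mem_nhds (by rw [hg1]; exact mem_interior_iff_mem_nhds.mp hy)
    obtain ⟨δ, hδ, hball⟩ := Metric.mem_nhds_iff.mp hnhds
    refine ⟨1 + δ / 2, by linarith, hball (a := 1 + δ / 2) ?_⟩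
    rw [Metric.mem_ball, Real.dist_eq]
    rw [abs_of_pos] <;> linarith
  obtain ⟨len, hlen, hlenw⟩ := htc
  refine ⟨fun e => t⁻¹ * len e + (1 - t⁻¹), fun e he => ?_, fun J => ?_⟩
  · have h1 : t⁻¹ < 1 := inv_lt_one_of_one_lt₀ ht
    have h2 : 0 < t⁻¹ := by positivity
    have := mul_nonneg h2.le (hlen e he)
    linarith
  · have hJ := hlenw J
    have hfin := Set.toFinite (T.pathEdges J.1.1 J.1.2)
    have hline : AffineMap.lineMap w₀ w t J = w₀ J + t * (w J - w₀ J) := by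
      rw [AffineMap.lineMap_apply]
      simp [add_comm]
    rw [hline] at hJ
    have h0 : w₀ J = -∑ᶠ e ∈ T.pathEdges J.1.1 J.1.2, (1 : ℝ) := rfl
    have hsum : ∑ᶠ e ∈ T.pathEdges J.1.1 J.1.2, (t⁻¹ * len e + (1 - t⁻¹)) =
        t⁻¹ * ∑ᶠ e ∈ T.pathEdges J.1.1 J.1.2, len e +
          (1 - t⁻¹) * ∑ᶠ e ∈ T.pathEdges J.1.1 J.1.2, (1 : ℝ) := by
      simp only [finsum_mem_eq_finite_toFinset_sum _ hfin, Finset.sum_add_distrib,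
        Finset.mul_sum, mul_one]
    rw [hsum]
    have ht0 : t ≠ 0 := by positivity
    field_simp
    rw [h0] at hJ
    linear_combination hJ

theorem isTreeWeight_of_mem_intrinsicInterior {n : ℕ} (S : IteratedSeq n) {w : OrdPair n → ℝ}
    (hw : w ∈ intrinsicInterior ℝ S.tree.cone) : IsTreeWeight S w := by
  obtain ⟨len, hlen, h⟩ := exists_pos_len_of_mem_intrinsicInterior _ hw
  refine isTreeWeight_of_innerDist S len hlen (fun l => -len (S.tree.leafEdge l)) w fun J => ?_
  rw [h J, S.leavesNotAdjacent.finsum_pathEdges len J.2.ne]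
  ring

/-! ### The valuation of an iterated sequence -/

section RootProduct

variable {n : ℕ}

/-- The first factor of the product has variable `y_0`, and the indices of the others are shifted. -/
theorem rootProduct_cons (a : OrdPair n) (l : List (OrdPair n)) :
    rootProduct (a :: l) = Matrix.transvection a.1.2 a.1.1 (X (0 : Fin (l.length + 1))) *
      (rootProduct l).map (rename (Fin.succ : Fin l.length → Fin (l.length + 1))) := by
  have h : rootProduct (a :: l) = (List.ofFn (n := l.length + 1) fun k =>
      Matrix.transvection ((a :: l).get k).1.2 ((a :: l).get k).1.1
        (X k : MvPolynomial (Fin (l.length + 1)) ℂ)).prod := rfl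
  rw [h, List.ofFn_succ, List.prod_cons]
  congr 1
  let φ := (rename (R := ℂ) (Fin.succ : Fin l.length → Fin (l.length + 1))).toRingHom.mapMatrix
    (m := Fin n)
  change _ = φ (rootProduct l)
  rw [rootProduct, map_list_prod, List.map_ofFn]
  congr 2
  funext k
  dsimp only [Function.comp_apply, Matrix.transvection, φ]
  rw [map_add, map_one, RingHom.mapMatrix_apply, Matrix.map_single, AlgHom.toRingHom_eq_coe,
    RingHom.coe_coe, rename_X]
  rfl

/-- The height of the roots of a sequence. -/
def rootHeight (S : List (OrdPair n)) (k : Fin S.length) : ℤ :=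
  ((S.get k).1.2 : ℤ) - ((S.get k).1.1 : ℤ)

theorem heightWeight_eq_weight (S : List (OrdPair n)) (u : Fin S.length →₀ ℕ) :
    heightWeight S (fun k => (u k : ℤ)) = Finsupp.weight (rootHeight S) u := by
  rw [heightWeight, Finsupp.weight_eq_sum]
  simp [rootHeight]

theorem isWeightedHomogeneous_list_prod {σ : Type*} (w : σ → ℤ)
    (l : List (Matrix (Fin n) (Fin n) (MvPolynomial σ ℂ)))
    (hl : ∀ A ∈ l, ∀ r c : Fin n, IsWeightedHomogeneous w (A r c) ((r : ℤ) - c)) (r c : Fin n) :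
    IsWeightedHomogeneous w (l.prod r c) ((r : ℤ) - c) := by
  induction l generalizing r c with
  | nil =>
    rw [List.prod_nil, Matrix.one_apply]
    split_ifs with h
    · rw [h, sub_self]
      exact isWeightedHomogeneous_one _ _
    · exact isWeightedHomogeneous_zero _ _ _
  | cons A l ih =>
    rw [List.prod_cons, Matrix.mul_apply]
    refine IsWeightedHomogeneous.sum _ _ _ fun k _ => ?_
    have := (hl A List.mem_cons_self r k).mul
      (ih (fun B hB => hl B (List.mem_cons_of_mem _ hB)) k c)
    rwa [sub_add_sub_cancel] at this

/-- The `(r, c)` entry of the product matrix is homogeneous of height `r - c`. -/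
theorem isWeightedHomogeneous_rootProduct (S : List (OrdPair n)) (r c : Fin n) :
    IsWeightedHomogeneous (rootHeight S) (rootProduct S r c) ((r : ℤ) - c) := by
  refine isWeightedHomogeneous_list_prod _ _ (fun A hA r c => ?_) r c
  obtain ⟨k, rfl⟩ := (List.mem_ofFn' _ _).mp hA
  dsimp only [Matrix.transvection, Matrix.add_apply]
  rw [Matrix.one_apply, Matrix.single_apply]
  refine IsWeightedHomogeneous.add ?_ ?_
  · split_ifs with h
    · rw [h, sub_self]
      exact isWeightedHomogeneous_one _ _
    · exact isWeightedHomogeneous_zero _ _ _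
  · split_ifs with h
    · rw [← h.1, ← h.2]
      exact isWeightedHomogeneous_X _ _ _
    · exact isWeightedHomogeneous_zero _ _ _

/-- The minor of the product matrix on rows `r`, `s` and its first two columns. -/
def rootMinor (hn : 2 ≤ n) (S : List (OrdPair n)) (r s : Fin n) :
    MvPolynomial (Fin S.length) ℂ :=
  rowMinor (fun r c => rootProduct S r (Fin.castLE hn c)) r s

theorem seqPullback_pluckerCoord (hn : 2 ≤ n) (S : List (OrdPair n)) (J : OrdPair n) :
    seqPullback hn S (pluckerCoord J) = rootMinor hn S J.1.1 J.1.2 := by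
  rw [seqPullback, pluckerCoord]
  refine (Ideal.Quotient.lift_mk _ _ _).trans ?_
  exact aeval_X _ J

theorem rootMinor_swap (hn : 2 ≤ n) (S : List (OrdPair n)) (r s : Fin n) :
    rootMinor hn S r s = -rootMinor hn S s r := by
  rw [rootMinor, rootMinor, rowMinor, rowMinor]
  ring

theorem rootMinor_self (hn : 2 ≤ n) (S : List (OrdPair n)) (r : Fin n) :
    rootMinor hn S r r = 0 := by
  rw [rootMinor, rowMinor]
  ring

theorem isWeightedHomogeneous_rootMinor (hn : 2 ≤ n) (S : List (OrdPair n)) (r s : Fin n) :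
    IsWeightedHomogeneous (rootHeight S) (rootMinor hn S r s) ((r : ℤ) + s - 1) := by
  have h := isWeightedHomogeneous_rootProduct S
  have h1 := (h r (Fin.castLE hn 0)).mul (h s (Fin.castLE hn 1))
  have h2 := (h r (Fin.castLE hn 1)).mul (h s (Fin.castLE hn 0))
  have e1 : ((r : ℤ) - (Fin.castLE hn 0 : Fin n)) + ((s : ℤ) - (Fin.castLE hn 1 : Fin n)) =
      (r : ℤ) + s - 1 := by simp; ring
  have e2 : ((r : ℤ) - (Fin.castLE hn 1 : Fin n)) + ((s : ℤ) - (Fin.castLE hn 0 : Fin n)) =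
      (r : ℤ) + s - 1 := by simp; ring
  rw [e1] at h1
  rw [e2] at h2
  exact h1.sub h2

/-- The first two rows of the product matrix have minor `1`, as the matrix is the identity at
`y = 0`. -/
theorem rootMinor_zero_one_ne_zero (hn : 2 ≤ n) (S : List (OrdPair n)) :
    rootMinor hn S (Fin.castLE hn 0) (Fin.castLE hn 1) ≠ 0 := by
  have h : (constantCoeff (σ := Fin S.length) (R := ℂ)).mapMatrix (rootProduct S) = 1 := by
    rw [rootProduct, map_list_prod, List.map_ofFn]
    refine List.prod_eq_one fun A hA => ?_
    obtain ⟨k, rfl⟩ := (List.mem_ofFn' _ _).mp hA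
    dsimp only [Function.comp_apply, Matrix.transvection]
    rw [map_add, map_one, RingHom.mapMatrix_apply, Matrix.map_single, constantCoeff_X,
      Matrix.single_zero, add_zero]
  have h' : ∀ r c, constantCoeff (rootProduct S r c) = (1 : Matrix (Fin n) (Fin n) ℂ) r c :=
    fun r c => congrFun (congrFun h r) c
  intro h0
  have := congrArg constantCoeff h0
  rw [rootMinor, rowMinor, map_sub, map_mul, map_mul, h', h', h', h'] at this
  simp [Fin.ext_iff] at this

/-! ### Extending a sequence -/

/-- The product matrix of a sequence for `n`, regarded as a sequence for `n + 1`, gets zero entries in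
the first `n` columns of its last row. -/
theorem rootProduct_map_castSucc (L : List (OrdPair n)) :
    (∀ r c : Fin n, rootProduct (L.map OrdPair.castSucc) r.castSucc c.castSucc =
      rename (Fin.cast (List.length_map OrdPair.castSucc).symm) (rootProduct L r c)) ∧
    ∀ c : Fin n, rootProduct (L.map OrdPair.castSucc) (Fin.last n) c.castSucc = 0 := by
  induction L with
  | nil =>
    constructor
    · intro r c
      simp [rootProduct, Matrix.one_apply, apply_ite]
    · intro c
      simp [rootProduct, (Fin.castSucc_ne_last c).symm]
  | cons a l ih =>
    obtain ⟨ih1, ih2⟩ := ih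
    have hren : ∀ p : MvPolynomial (Fin l.length) ℂ,
        rename Fin.succ (rename (Fin.cast (List.length_map OrdPair.castSucc).symm) p) =
        rename (Fin.cast (List.length_map (as := a :: l) OrdPair.castSucc).symm)
          (rename Fin.succ p) := by
      intro p
      rw [rename_rename, rename_rename]
      rfl
    constructor
    · intro r c
      change rootProduct (a.castSucc :: l.map OrdPair.castSucc) _ _ = _
      rw [rootProduct_cons, rootProduct_cons]
      by_cases hr : r = a.1.2
      · subst hr
        have h1 : (OrdPair.castSucc a).1.2 = a.1.2.castSucc := rfl
        rw [h1, Matrix.transvection_mul_apply_same, Matrix.transvection_mul_apply_same]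
        simp only [Matrix.map_apply]
        rw [show (OrdPair.castSucc a).1.1 = a.1.1.castSucc from rfl, ih1, ih1, map_add, map_mul,
          hren, hren, rename_X]
        rfl
      · rw [Matrix.transvection_mul_apply_of_ne _ _ _ _ hr, Matrix.transvection_mul_apply_of_ne,
          Matrix.map_apply, Matrix.map_apply, ih1, hren]
        rw [show (OrdPair.castSucc a).1.2 = a.1.2.castSucc from rfl]
        simpa using hr
    · intro c
      change rootProduct (a.castSucc :: l.map OrdPair.castSucc) _ _ = 0
      rw [rootProduct_cons, Matrix.transvection_mul_apply_of_ne, Matrix.map_apply, ih2, map_zero]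
      exact (Fin.castSucc_ne_last _).symm

/-- The sequence `(ε_i - ε_{n+1}, ε_j - ε_{n+1}, S)`. -/
abbrev extendRoots (i j : Fin n) (L : List (OrdPair n)) : List (OrdPair (n + 1)) :=
  OrdPair.toLast i :: OrdPair.toLast j :: L.map OrdPair.castSucc

variable (i j : Fin n) (L : List (OrdPair n))

/-- The position in the extended sequence of the entries of the old one. -/
def extendIdx (k : Fin L.length) : Fin (extendRoots i j L).length :=
  (Fin.cast (List.length_map OrdPair.castSucc).symm k).succ.succ

/-- The position of `ε_i - ε_{n+1}` in the extended sequence. -/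
def extendFst : Fin (extendRoots i j L).length := ⟨0, Nat.succ_pos _⟩

/-- The position of `ε_j - ε_{n+1}` in the extended sequence. -/
def extendSnd : Fin (extendRoots i j L).length := ⟨1, Nat.succ_lt_succ (Nat.succ_pos _)⟩

theorem rename_extendIdx (p : MvPolynomial (Fin L.length) ℂ) :
    rename Fin.succ (rename Fin.succ
      (rename (Fin.cast (List.length_map OrdPair.castSucc).symm) p)) =
    rename (extendIdx i j L) p := by
  rw [rename_rename, rename_rename]
  rfl

theorem rootProduct_extendRoots_castSucc (r c : Fin n) :
    rootProduct (extendRoots i j L) r.castSucc c.castSucc =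
      rename (extendIdx i j L) (rootProduct L r c) := by
  have hr : ∀ k : Fin n, r.castSucc ≠ (OrdPair.toLast k).1.2 := fun _ => Fin.castSucc_ne_last r
  rw [rootProduct_cons, Matrix.transvection_mul_apply_of_ne _ _ _ _ (hr i), Matrix.map_apply,
    rootProduct_cons, Matrix.transvection_mul_apply_of_ne _ _ _ _ (hr j), Matrix.map_apply,
    (rootProduct_map_castSucc L).1]
  exact rename_extendIdx i j L _

theorem rootProduct_extendRoots_last (c : Fin n) :
    rootProduct (extendRoots i j L) (Fin.last n) c.castSucc =
      X (extendFst i j L) * rename (extendIdx i j L) (rootProduct L i c) +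
        X (extendSnd i j L) * rename (extendIdx i j L) (rootProduct L j c) := by
  have h2 : ∀ k : Fin n, (OrdPair.toLast k).1.2 = Fin.last n := fun _ => rfl
  have h1 : ∀ k : Fin n, (OrdPair.toLast k).1.1 = k.castSucc := fun _ => rfl
  rw [rootProduct_cons, rootProduct_cons, h2, h2, h1, h1, Matrix.transvection_mul_apply_same,
    Matrix.map_apply, Matrix.map_apply, Matrix.transvection_mul_apply_same,
    Matrix.transvection_mul_apply_of_ne _ _ _ _ (Fin.castSucc_ne_last i),
    Matrix.map_apply, Matrix.map_apply, Matrix.map_apply, (rootProduct_map_castSucc L).1,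
    (rootProduct_map_castSucc L).1, (rootProduct_map_castSucc L).2, map_zero, zero_add, map_mul,
    rename_X, rename_extendIdx, rename_extendIdx]
  exact add_comm _ _

variable (hn : 2 ≤ n) (hn' : 2 ≤ n + 1)

theorem castLE_eq_castSucc (c : Fin 2) : Fin.castLE hn' c = (Fin.castLE hn c).castSucc := rfl

theorem rootMinor_extendRoots_castSucc (r s : Fin n) :
    rootMinor hn' (extendRoots i j L) r.castSucc s.castSucc =
      rename (extendIdx i j L) (rootMinor hn L r s) := by
  simp only [rootMinor, rowMinor, castLE_eq_castSucc hn hn', rootProduct_extendRoots_castSucc,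
    map_sub, map_mul]

theorem rootMinor_extendRoots_last (r : Fin n) :
    rootMinor hn' (extendRoots i j L) r.castSucc (Fin.last n) =
      X (extendFst i j L) * rename (extendIdx i j L) (rootMinor hn L r i) +
        X (extendSnd i j L) * rename (extendIdx i j L) (rootMinor hn L r j) := by
  simp only [rootMinor, rowMinor, castLE_eq_castSucc hn hn', rootProduct_extendRoots_castSucc,
    rootProduct_extendRoots_last, map_sub, map_mul]
  ring

end RootProduct

/-! ### Lowest exponents and the columns of the weighting matrix -/

section LowestExponent

variable {n : ℕ}

/-- `v` is the lexicographically largest exponent of `f`. -/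
def IsLexLeading {d : ℕ} (f : MvPolynomial (Fin d) ℂ) (v : Fin d →₀ ℕ) : Prop :=
  v ∈ f.support ∧ ∀ u ∈ f.support,
    toLex (fun k => (u k : ℤ)) ≤ toLex (fun k => (v k : ℤ))

theorem exists_isLexLeading {d : ℕ} {f : MvPolynomial (Fin d) ℂ} (hf : f ≠ 0) :
    ∃ v, IsLexLeading f v :=
  Finset.exists_max_image f.support (fun u => toLex (fun k => (u k : ℤ)))
    (Finset.nonempty_iff_ne_empty.mpr (by simpa using hf))

theorem IsLexLeading.ne_zero {d : ℕ} {f : MvPolynomial (Fin d) ℂ} {v : Fin d →₀ ℕ}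
    (h : IsLexLeading f v) : f ≠ 0 := by
  rintro rfl
  simpa using h.1

theorem IsLexLeading.neg {d : ℕ} {f : MvPolynomial (Fin d) ℂ} {v : Fin d →₀ ℕ}
    (h : IsLexLeading f v) : IsLexLeading (-f) v := by
  rwa [IsLexLeading, support_neg]

/-- On polynomials which are homogeneous for the height, the lowest exponent for `≺_Ψ` is the
lexicographically largest one. -/
theorem lowestExp_eq {S : List (OrdPair n)} {f : MvPolynomial (Fin S.length) ℂ} {d : ℤ}
    (hf : IsWeightedHomogeneous (rootHeight S) f d) {v : Fin S.length →₀ ℕ}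
    (hv : IsLexLeading f v) : lowestExp S f = fun k => (v k : ℤ) := by
  have hf0 := hv.ne_zero
  rw [lowestExp, dif_pos hf0]
  obtain ⟨hu, hmin⟩ := (exists_lowestExp S f hf0).choose_spec
  set u := (exists_lowestExp S f hf0).choose
  have hle := hmin v hv.1
  have h1 : ∀ x ∈ f.support, heightWeight S (fun k => (x k : ℤ)) = d := fun x hx => by
    rw [heightWeight_eq_weight, hf (mem_support_iff.mp hx)]
  rw [← not_lt, psiKey_lt_iff, h1 _ hu, h1 _ hv.1] at hle
  push Not at hle
  exact toLex.injective (le_antisymm (hv.2 u hu) (not_lt.mp (hle.2 rfl)))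

/-- The columns of the weighting matrix as weights with values in an ordered group which induces the
order `≺_Ψ`. -/
def columnWeight (hn : 2 ≤ n) (S : List (OrdPair n)) (J : OrdPair n) :
    ℤ ×ₗ (Lex (Fin S.length → ℤ))ᵒᵈ :=
  psiKey S fun k => weightMatrix hn S k J

theorem psiKey_add (S : List (OrdPair n)) (m m' : Fin S.length → ℤ) :
    psiKey S (m + m') = psiKey S m + psiKey S m' := by
  have h : heightWeight S (m + m') = heightWeight S m + heightWeight S m' := by
    simp only [heightWeight, Pi.add_apply, add_mul, Finset.sum_add_distrib]
  rw [psiKey, h]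
  rfl

theorem psiKey_zero (S : List (OrdPair n)) : psiKey S 0 = 0 := by
  have h := psiKey_add S 0 0
  rw [add_zero] at h
  exact left_eq_add.mp h

/-- The map `psiKey` as a homomorphism. -/
def psiKeyHom (S : List (OrdPair n)) :
    (Fin S.length → ℤ) →+ ℤ ×ₗ (Lex (Fin S.length → ℤ))ᵒᵈ where
  toFun := psiKey S
  map_zero' := psiKey_zero S
  map_add' := psiKey_add S

theorem psiKey_mulVec_weightMatrix (hn : 2 ≤ n) (S : List (OrdPair n)) (m : OrdPair n →₀ ℕ) :
    psiKey S ((weightMatrix hn S).mulVec fun j => (m j : ℤ)) =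
      Finsupp.weight (columnWeight hn S) m := by
  have h : (weightMatrix hn S).mulVec (fun j => (m j : ℤ)) =
      ∑ J, m J • fun k => weightMatrix hn S k J := by
    ext k
    rw [Matrix.mulVec, dotProduct, Finset.sum_apply]
    simp [mul_comm]
  rw [h, Finsupp.weight_eq_sum]
  change psiKeyHom S _ = _
  rw [map_sum]
  refine Finset.sum_congr rfl fun J _ => ?_
  rw [map_nsmul]
  rfl

theorem symWeight_columnWeight (hn : 2 ≤ n) (S : List (OrdPair n)) {r s : Fin n} (hrs : r ≠ s)
    {v : Fin S.length →₀ ℕ} (hv : IsLexLeading (rootMinor hn S r s) v) :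
    symWeight (columnWeight hn S) r s = psiKey S fun k => (v k : ℤ) := by
  have key : ∀ J : OrdPair n, IsLexLeading (rootMinor hn S J.1.1 J.1.2) v →
      columnWeight hn S J = psiKey S fun k => (v k : ℤ) := by
    intro J hJ
    have h := lowestExp_eq (isWeightedHomogeneous_rootMinor hn S J.1.1 J.1.2) hJ
    rw [columnWeight]
    congr 1
    rw [← h]
    funext k
    rw [weightMatrix, Matrix.of_apply, seqVal, seqPullback_pluckerCoord]
  rcases hrs.lt_or_gt with h | h
  · rw [← key ⟨(r, s), h⟩ hv, ← symWeight_ordPair (columnWeight hn S)]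
  · have hv' := hv.neg
    rw [← rootMinor_swap] at hv'
    rw [← key ⟨(s, r), h⟩ hv', symWeight_comm,
      ← symWeight_ordPair (columnWeight hn S)]

theorem heightWeight_of_isLexLeading (hn : 2 ≤ n) (S : List (OrdPair n)) {r s : Fin n}
    {v : Fin S.length →₀ ℕ} (hv : IsLexLeading (rootMinor hn S r s) v) :
    heightWeight S (fun k => (v k : ℤ)) = (r : ℤ) + s - 1 := by
  rw [heightWeight_eq_weight]
  exact isWeightedHomogeneous_rootMinor hn S r s (mem_support_iff.mp hv.1)

end LowestExponent

theorem IsTreeWeight.map {Γ Γ' : Type*} [AddCommGroup Γ] [LinearOrder Γ] [AddCommGroup Γ']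
    [LinearOrder Γ'] (φ : Γ →+ Γ') (hφ : StrictMono φ) {n : ℕ} {S : IteratedSeq n}
    {w : OrdPair n → Γ} (hw : IsTreeWeight S w) : IsTreeWeight S fun J => φ (w J) := by
  have hsym : ∀ {n : ℕ} (w : OrdPair n → Γ) (r s : Fin n),
      symWeight (fun J => φ (w J)) r s = φ (symWeight w r s) := by
    intro n w r s
    simp only [symWeight]
    split_ifs
    · rfl
    · rfl
    · rw [map_zero]
  induction S with
  | base S hS => trivial
  | extend i j hij S ih =>
    obtain ⟨h, ⟨a, ha⟩, hlt⟩ := hw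
    refine ⟨ih h, ⟨φ a, fun r hr => ?_⟩, fun r s hr hs hrs => ?_⟩
    · rw [hsym, hsym, ha r hr, map_add]
    · simp only [hsym, ← map_add]
      exact hφ (hlt r s hr hs hrs)

section Extension

variable {n : ℕ} (i j : Fin n) (L : List (OrdPair n))

theorem extendIdx_cases (k : Fin (extendRoots i j L).length) :
    k = extendFst i j L ∨ k = extendSnd i j L ∨ ∃ k', extendIdx i j L k' = k := by
  obtain ⟨k, hk⟩ := k
  rcases k with _ | _ | k
  · exact Or.inl rfl
  · exact Or.inr (Or.inl rfl)
  · refine Or.inr (Or.inr ⟨⟨k, ?_⟩, rfl⟩)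
    simpa [extendRoots] using hk

theorem extendIdx_strictMono : StrictMono (extendIdx i j L) := by
  intro k k' h
  exact Nat.succ_lt_succ (Nat.succ_lt_succ h)

theorem extendIdx_ne_fst (k : Fin L.length) : extendIdx i j L k ≠ extendFst i j L :=
  fun h => Nat.succ_ne_zero _ (Fin.ext_iff.mp h)

theorem extendIdx_ne_snd (k : Fin L.length) : extendIdx i j L k ≠ extendSnd i j L :=
  fun h => Nat.succ_ne_zero _ (Nat.succ_injective (Fin.ext_iff.mp h))

theorem extendFst_ne_extendSnd : extendFst i j L ≠ extendSnd i j L :=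
  fun h => Nat.zero_ne_one (Fin.ext_iff.mp h)

/-- Extension of a vector by zero at the two new positions. -/
def extendVec : (Fin L.length → ℤ) →+ (Fin (extendRoots i j L).length → ℤ) where
  toFun v := Function.extend (extendIdx i j L) v 0
  map_zero' := by
    ext k
    by_cases h : ∃ k', extendIdx i j L k' = k
    · obtain ⟨k', rfl⟩ := h
      rw [(extendIdx_strictMono i j L).injective.extend_apply]
      rfl
    · rw [Function.extend_apply' _ _ _ h]
  map_add' u v := by
    ext k
    by_cases h : ∃ k', extendIdx i j L k' = k
    · obtain ⟨k', rfl⟩ := h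
      simp [(extendIdx_strictMono i j L).injective.extend_apply]
    · simp [Function.extend_apply' _ _ _ h]

theorem extendVec_idx (v : Fin L.length → ℤ) (k : Fin L.length) :
    extendVec i j L v (extendIdx i j L k) = v k :=
  (extendIdx_strictMono i j L).injective.extend_apply _ _ _

theorem extendVec_fst (v : Fin L.length → ℤ) : extendVec i j L v (extendFst i j L) = 0 :=
  Function.extend_apply' _ _ _ fun ⟨k, h⟩ => extendIdx_ne_fst i j L k h

theorem extendVec_snd (v : Fin L.length → ℤ) : extendVec i j L v (extendSnd i j L) = 0 :=
  Function.extend_apply' _ _ _ fun ⟨k, h⟩ => extendIdx_ne_snd i j L k h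

theorem extendVec_lt {u v : Fin L.length → ℤ} (h : toLex u < toLex v) :
    toLex (extendVec i j L u) < toLex (extendVec i j L v) := by
  obtain ⟨k, hk, hlt⟩ := h
  refine ⟨extendIdx i j L k, fun k' hk' => ?_, ?_⟩
  · rcases extendIdx_cases i j L k' with rfl | rfl | ⟨k', rfl⟩
    · simp only [Pi.toLex_apply, extendVec_fst]
    · simp only [Pi.toLex_apply, extendVec_snd]
    · simp only [Pi.toLex_apply, extendVec_idx]
      exact hk k' ((extendIdx_strictMono i j L).lt_iff_lt.mp hk')
  · simp only [Pi.toLex_apply, extendVec_idx]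
    exact hlt

theorem heightWeight_extendVec (v : Fin L.length → ℤ) :
    heightWeight (extendRoots i j L) (extendVec i j L v) = heightWeight L v := by
  rw [heightWeight, heightWeight]
  symm
  refine Finset.sum_of_injOn (extendIdx i j L) (extendIdx_strictMono i j L).injective.injOn
    (fun _ _ => Finset.mem_coe.mpr (Finset.mem_univ _)) ?_ ?_
  · intro k _ hk
    rcases extendIdx_cases i j L k with rfl | rfl | ⟨k', rfl⟩
    · rw [extendVec_fst, zero_mul]
    · rw [extendVec_snd, zero_mul]
    · exact absurd ⟨k', Finset.mem_coe.mpr (Finset.mem_univ _), rfl⟩ hk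
  · intro k _
    rw [extendVec_idx]
    have : (extendRoots i j L).get (extendIdx i j L k) = (L.get k).castSucc := by
      simp [extendRoots, extendIdx]
    rw [this]
    rfl

/-- The inclusion of the value groups which belongs to the extension of a sequence. -/
def extendKey : ℤ ×ₗ (Lex (Fin L.length → ℤ))ᵒᵈ →+
    ℤ ×ₗ (Lex (Fin (extendRoots i j L).length → ℤ))ᵒᵈ where
  toFun x := toLex ((ofLex x).1,
    OrderDual.toDual (toLex (extendVec i j L (ofLex (OrderDual.ofDual (ofLex x).2)))))
  map_zero' := by
    have h : extendVec i j L (ofLex (OrderDual.ofDual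
        (ofLex (0 : ℤ ×ₗ (Lex (Fin L.length → ℤ))ᵒᵈ)).2)) = 0 := map_zero (extendVec i j L)
    rw [h]
    rfl
  map_add' x y := by
    have h : extendVec i j L (ofLex (OrderDual.ofDual (ofLex (x + y)).2)) =
        extendVec i j L (ofLex (OrderDual.ofDual (ofLex x).2)) +
          extendVec i j L (ofLex (OrderDual.ofDual (ofLex y).2)) := map_add (extendVec i j L) _ _
    rw [h]
    rfl

theorem extendKey_psiKey (m : Fin L.length → ℤ) :
    extendKey i j L (psiKey L m) = psiKey (extendRoots i j L) (extendVec i j L m) := by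
  rw [psiKey, psiKey, heightWeight_extendVec]
  rfl

theorem extendKey_strictMono : StrictMono (extendKey i j L) := by
  intro x y h
  rw [Prod.Lex.lt_iff] at h
  refine Prod.Lex.lt_iff.mpr (h.imp_right fun h => ⟨h.1, ?_⟩)
  exact OrderDual.toDual_lt_toDual.mpr (extendVec_lt i j L h.2)

theorem IsLexLeading.rename_extendIdx {f : MvPolynomial (Fin L.length) ℂ}
    {v : Fin L.length →₀ ℕ} (hv : IsLexLeading f v) :
    IsLexLeading (rename (extendIdx i j L) f) (v.mapDomain (extendIdx i j L)) ∧
      (fun k => ((v.mapDomain (extendIdx i j L) k : ℕ) : ℤ)) =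
        extendVec i j L fun k => (v k : ℤ) := by
  have hinj := (extendIdx_strictMono i j L).injective
  have hcast : ∀ u : Fin L.length →₀ ℕ, (fun k => ((u.mapDomain (extendIdx i j L) k : ℕ) : ℤ)) =
      extendVec i j L fun k => (u k : ℤ) := by
    intro u
    funext k
    by_cases h : ∃ k', extendIdx i j L k' = k
    · obtain ⟨k', rfl⟩ := h
      rw [Finsupp.mapDomain_apply hinj, extendVec_idx]
    · rw [Finsupp.mapDomain_of_notMem_range _ _ (by rintro ⟨k', hk'⟩; exact h ⟨k', hk'⟩)]
      exact (Function.extend_apply' (f := extendIdx i j L) (fun k => (u k : ℤ))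
        (fun _ => (0 : ℤ)) k h).symm
  refine ⟨⟨?_, ?_⟩, hcast v⟩
  · rw [mem_support_iff, coeff_rename_mapDomain _ hinj]
    exact mem_support_iff.mp hv.1
  · classical
    intro u hu
    rw [support_rename_of_injective hinj, Finset.mem_image] at hu
    obtain ⟨u, hu, rfl⟩ := hu
    rw [hcast, hcast]
    rcases (hv.2 u hu).eq_or_lt with h | h
    · rw [toLex.injective h]
    · exact (extendVec_lt i j L h).le

theorem natCast_single_add {d : ℕ} (k : Fin d) (u : Fin d →₀ ℕ) :
    (fun k' => (((Finsupp.single k 1 + u : Fin d →₀ ℕ) k' : ℕ) : ℤ)) =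
      Pi.single k 1 + fun k' => (u k' : ℤ) := by
  funext k'
  rw [Finsupp.add_apply, Nat.cast_add, Pi.add_apply, Finsupp.single_apply, Pi.single_apply]
  congr 1
  by_cases h : k = k'
  · rw [if_pos h, if_pos h.symm, Nat.cast_one]
  · rw [if_neg h, if_neg (Ne.symm h), Nat.cast_zero]

theorem IsLexLeading.X_mul {d : ℕ} {f : MvPolynomial (Fin d) ℂ} {v : Fin d →₀ ℕ}
    (hv : IsLexLeading f v) (k : Fin d) : IsLexLeading (X k * f) (Finsupp.single k 1 + v) := by
  refine ⟨?_, fun u hu => ?_⟩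
  · rw [support_X_mul, Finset.mem_map]
    exact ⟨v, hv.1, rfl⟩
  · rw [support_X_mul, Finset.mem_map] at hu
    obtain ⟨u, hu, rfl⟩ := hu
    rw [addLeftEmbedding_apply, natCast_single_add, natCast_single_add, toLex_add, toLex_add]
    gcongr
    exact hv.2 u hu

theorem IsLexLeading.add_of_lt {d : ℕ} {f g : MvPolynomial (Fin d) ℂ} {v : Fin d →₀ ℕ}
    (hv : IsLexLeading f v)
    (hg : ∀ u ∈ g.support, toLex (fun k => (u k : ℤ)) < toLex (fun k => (v k : ℤ))) :
    IsLexLeading (f + g) v := by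
  classical
  refine ⟨?_, fun u hu => ?_⟩
  · have hgv : coeff v g = 0 := by
      by_contra h
      exact lt_irrefl _ (hg v (mem_support_iff.mpr h))
    rw [mem_support_iff, coeff_add, hgv, add_zero]
    exact mem_support_iff.mp hv.1
  · rcases Finset.mem_union.mp (support_add hu) with h | h
    · exact hv.2 u h
    · exact (hg u h).le

theorem isLexLeading_extend_snd {f : MvPolynomial (Fin L.length) ℂ}
    {v : Fin L.length →₀ ℕ} (hv : IsLexLeading f v) :
    ∃ v', IsLexLeading (X (extendSnd i j L) * rename (extendIdx i j L) f) v' ∧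
      (fun k => ((v' k : ℕ) : ℤ)) =
        Pi.single (extendSnd i j L) 1 + extendVec i j L fun k => (v k : ℤ) := by
  obtain ⟨h, he⟩ := hv.rename_extendIdx i j L
  exact ⟨_, h.X_mul _, by rw [natCast_single_add, he]⟩

/-- In `y₀ f + y₁ g`, where `f ≠ 0` and `g` do not involve `y₀` and `y₁`, the leading exponent comes
from `y₀ f`. -/
theorem isLexLeading_extend_add {f : MvPolynomial (Fin L.length) ℂ}
    (g : MvPolynomial (Fin L.length) ℂ) {v : Fin L.length →₀ ℕ} (hv : IsLexLeading f v) :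
    ∃ v', IsLexLeading (X (extendFst i j L) * rename (extendIdx i j L) f +
        X (extendSnd i j L) * rename (extendIdx i j L) g) v' ∧
      (fun k => ((v' k : ℕ) : ℤ)) =
        Pi.single (extendFst i j L) 1 + extendVec i j L fun k => (v k : ℤ) := by
  classical
  obtain ⟨h, he⟩ := hv.rename_extendIdx i j L
  refine ⟨_, (h.X_mul _).add_of_lt fun u hu => ?_, by rw [natCast_single_add, he]⟩
  rw [support_X_mul, Finset.mem_map] at hu
  obtain ⟨u, hu, rfl⟩ := hu
  rw [support_rename_of_injective (extendIdx_strictMono i j L).injective, Finset.mem_image] at hu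
  obtain ⟨u, hu, rfl⟩ := hu
  -- the first coordinates are `0` and `1`
  refine ⟨extendFst i j L, fun k hk => absurd hk (Nat.not_lt_zero _), ?_⟩
  have h0 : ∀ u : Fin L.length →₀ ℕ, u.mapDomain (extendIdx i j L) (extendFst i j L) = 0 :=
    fun u => Finsupp.mapDomain_of_notMem_range _ _
      (by rintro ⟨k, hk⟩; exact extendIdx_ne_fst i j L k hk)
  simp [h0, (extendFst_ne_extendSnd i j L).symm]

variable (hn : 2 ≤ n) (hn' : 2 ≤ n + 1)

theorem rootMinor_extendRoots_ne_zero {i j : Fin n} (hij : i ≠ j)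
    (hL : ∀ r s, r ≠ s → rootMinor hn L r s ≠ 0) (r s : Fin (n + 1)) (hrs : r ≠ s) :
    rootMinor hn' (extendRoots i j L) r s ≠ 0 := by
  have key : ∀ r : Fin n, rootMinor hn' (extendRoots i j L) r.castSucc (Fin.last n) ≠ 0 := by
    intro r
    rw [rootMinor_extendRoots_last i j L hn hn']
    by_cases hr : r = i
    · obtain ⟨v, hv⟩ := exists_isLexLeading (hL i j hij)
      obtain ⟨v', hv', -⟩ := isLexLeading_extend_snd i j L hv
      rw [hr, rootMinor_self, map_zero, mul_zero, zero_add]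
      exact hv'.ne_zero
    · obtain ⟨v, hv⟩ := exists_isLexLeading (hL r i hr)
      obtain ⟨v', hv', -⟩ := isLexLeading_extend_add i j L (rootMinor hn L r j) hv
      exact hv'.ne_zero
  induction r using Fin.lastCases with
  | last =>
    induction s using Fin.lastCases with
    | last => exact absurd rfl hrs
    | cast s =>
      rw [rootMinor_swap]
      exact neg_ne_zero.mpr (key s)
  | cast r =>
    induction s using Fin.lastCases with
    | last => exact key r
    | cast s =>
      rw [rootMinor_extendRoots_castSucc i j L hn hn']
      obtain ⟨v, hv⟩ := exists_isLexLeading (hL r s (by simpa using hrs))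
      exact (hv.rename_extendIdx i j L).1.ne_zero

end Extension

/-- The Plücker coordinates have non-zero pullbacks for an iterated sequence. For three leaves this
is the birationality of the sequence. -/
theorem rootMinor_ne_zero {n : ℕ} (S : IteratedSeq n) (r s : Fin n) (hrs : r ≠ s) :
    rootMinor S.two_le S.roots r s ≠ 0 := by
  induction S with
  | base S hS =>
    have hn : 2 ≤ 3 := by norm_num
    have h01 : rootMinor hn S 0 1 ≠ 0 := rootMinor_zero_one_ne_zero hn S
    have h2 : ∀ r : Fin 3, ∀ h : r < 2, rootMinor hn S r 2 ≠ 0 := by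
      intro r h
      have h' : (r : ℕ) < 2 := h
      have := hS.dominant.ne_zero ⟨⟨(r, 2), h⟩, h', le_rfl⟩
      rwa [cellPullback, seqPullback_pluckerCoord] at this
    have key : ∀ r s : Fin 3, r < s → rootMinor hn S r s ≠ 0 := by
      intro r s h
      have hcases : s = 2 ∨ (r = 0 ∧ s = 1) := by omega
      rcases hcases with rfl | ⟨rfl, rfl⟩
      · exact h2 r h
      · exact h01
    rcases hrs.lt_or_gt with h | h
    · exact key r s h
    · change rootMinor hn S r s ≠ 0
      rw [rootMinor_swap]
      exact neg_ne_zero.mpr (key s r h)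
  | extend i j hij S ih => exact rootMinor_extendRoots_ne_zero _ S.two_le _ hij ih r s hrs

/-- The columns of the weighting matrix form a tree weight. -/
theorem isTreeWeight_columnWeight {n : ℕ} (S : IteratedSeq n) :
    IsTreeWeight S (columnWeight S.two_le S.roots) := by
  induction S with
  | base S hS => trivial
  | @extend n i j hij S ih =>
    have hn := S.two_le
    have hn' : 2 ≤ n + 1 := hn.trans n.le_succ
    set L := S.roots
    change IsTreeWeight (.extend i j hij S) (columnWeight hn' (extendRoots i j L))
    have hne : ∀ r : Fin n, r.castSucc ≠ Fin.last n := Fin.castSucc_ne_last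
    have hne' : ∀ {r s : Fin n}, r ≠ s → r.castSucc ≠ s.castSucc := fun h => by simpa using h
    choose! v hv using fun r s hrs => exists_isLexLeading (rootMinor_ne_zero S r s hrs)
    set V : Fin n → Fin n → Fin (extendRoots i j L).length → ℤ := fun r s =>
      extendVec i j L fun k => (v r s k : ℤ) with hV
    have hcol : ∀ r s, r ≠ s →
        symWeight (columnWeight hn' (extendRoots i j L)) r.castSucc s.castSucc =
          psiKey (extendRoots i j L) (V r s) ∧
        heightWeight (extendRoots i j L) (V r s) = (r : ℤ) + s - 1 := by
      intro r s hrs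
      have h := (hv r s hrs).rename_extendIdx i j L
      rw [← rootMinor_extendRoots_castSucc i j L hn hn'] at h
      have h1 := symWeight_columnWeight hn' _ (hne' hrs) h.1
      have h2 := heightWeight_of_isLexLeading hn' _ h.1
      rw [h.2] at h1 h2
      exact ⟨h1, by simpa using h2⟩
    have hlast : ∀ r, r ≠ i →
        symWeight (columnWeight hn' (extendRoots i j L)) r.castSucc (Fin.last n) =
          psiKey (extendRoots i j L) (Pi.single (extendFst i j L) 1 + V r i) ∧
        heightWeight (extendRoots i j L) (Pi.single (extendFst i j L) 1 + V r i) =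
          (r : ℤ) + n - 1 := by
      intro r hr
      obtain ⟨v', h, he⟩ := isLexLeading_extend_add i j L (rootMinor hn L r j) (hv r i hr)
      rw [← rootMinor_extendRoots_last i j L hn hn'] at h
      have h1 := symWeight_columnWeight hn' _ (hne r) h
      have h2 := heightWeight_of_isLexLeading hn' _ h
      rw [he] at h1 h2
      exact ⟨h1, by simpa using h2⟩
    have hself : symWeight (columnWeight hn' (extendRoots i j L)) i.castSucc (Fin.last n) =
          psiKey (extendRoots i j L) (Pi.single (extendSnd i j L) 1 + V i j) ∧
        heightWeight (extendRoots i j L) (Pi.single (extendSnd i j L) 1 + V i j) =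
          (i : ℤ) + n - 1 := by
      obtain ⟨v', h, he⟩ := isLexLeading_extend_snd i j L (hv i j hij)
      have hm := rootMinor_extendRoots_last i j L hn hn' i
      rw [rootMinor_self, map_zero, mul_zero, zero_add] at hm
      rw [← hm] at h
      have h1 := symWeight_columnWeight hn' _ (hne i) h
      have h2 := heightWeight_of_isLexLeading hn' _ h
      rw [he] at h1 h2
      exact ⟨h1, by simpa using h2⟩
    refine ⟨?_, ⟨psiKey _ (Pi.single (extendFst i j L) 1), fun r hr => ?_⟩,
      fun r s hr hs hrs => ?_⟩
    · convert ih.map (extendKey i j L) (extendKey_strictMono i j L) using 1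
      funext J
      have h1 := (hcol J.1.1 J.1.2 J.2.ne).1
      rw [← symWeight_ordPair (columnWeight S.two_le S.roots) J,
        symWeight_columnWeight _ _ J.2.ne (hv _ _ J.2.ne), extendKey_psiKey]
      rw [← h1, ← symWeight_ordPair (columnWeight hn' (extendRoots i j L))]
      rfl
    · rw [(hlast r hr).1, (hcol r i hr).1, psiKey_add]
    · -- both sides have the same height, and only the left-hand side involves `y₀`
      rw [(hlast r hr).1, (hcol i s (Ne.symm hs)).1, hself.1, (hcol r s hrs).1, ← psiKey_add,
        ← psiKey_add, psiKey_lt_iff]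
      have hadd : ∀ m m' : Fin (extendRoots i j L).length → ℤ,
          heightWeight (extendRoots i j L) (m + m') =
            heightWeight (extendRoots i j L) m + heightWeight (extendRoots i j L) m' :=
        fun m m' => by simp only [heightWeight, Pi.add_apply, add_mul, Finset.sum_add_distrib]
      refine Or.inr ⟨?_, ⟨extendFst i j L, fun k hk => absurd hk (Nat.not_lt_zero _), ?_⟩⟩
      · rw [hadd, (hlast r hr).2, (hcol i s (Ne.symm hs)).2, hadd, hself.2, (hcol r s hrs).2]
        ring
      · have hV0 : ∀ r s, V r s (extendFst i j L) = 0 := fun r s => extendVec_fst i j L _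
        change (Pi.single (extendSnd i j L) 1 + V i j + V r s : _ → ℤ) (extendFst i j L) <
          (Pi.single (extendFst i j L) 1 + V r i + V i s : _ → ℤ) (extendFst i j L)
        rw [Pi.add_apply, Pi.add_apply, Pi.add_apply, Pi.add_apply, hV0, hV0, hV0, hV0,
          Pi.single_eq_same, Pi.single_eq_of_ne (extendFst_ne_extendSnd i j L)]
        norm_num

theorem initIdealMat_eq {n : ℕ} (hn : 2 ≤ n) (S : List (OrdPair n))
    (I : Ideal (MvPolynomial (OrdPair n) ℂ)) : initIdealMat S (weightMatrix hn S) I =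
      initIdeal (Finsupp.weight (columnWeight hn S)) I := by
  rw [initIdealMat]
  congr 1
  funext m
  exact psiKey_mulVec_weightMatrix hn S m

theorem initIdealVec_eq {σ : Type*} [Fintype σ] (w : σ → ℝ) (I : Ideal (MvPolynomial σ ℂ)) :
    initIdealVec w I = initIdeal (Finsupp.weight w) I := by
  rw [initIdealVec]
  congr 1
  funext m
  rw [Finsupp.weight_eq_sum]
  simp [mul_comm]

end

theorem mainTheorem3 (n : ℕ) (S : IteratedSeq n) :
    initIdealMat S.roots (weightMatrix S.two_le S.roots) (pluckerIdeal n) =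
        initIdealVec S.tree.weightVector (pluckerIdeal n) ∧
      ∀ w ∈ intrinsicInterior ℝ S.tree.cone,
        initIdealMat S.roots (weightMatrix S.two_le S.roots) (pluckerIdeal n) =
          initIdealVec w (pluckerIdeal n) := by
  simp only [initIdealMat_eq, initIdealVec_eq, (isTreeWeight_columnWeight S).initIdeal_eq]
  refine ⟨(isTreeWeight_weightVector S).initIdeal_eq.symm, fun w hw => ?_⟩
  exact (isTreeWeight_of_mem_intrinsicInterior S hw).initIdeal_eq.symm
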